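/- Let $\mathbf k$ be a field of characteristic zero, $A=\bigoplus_{n\in\mathbb Z}A_n$ a graded vector space with every $A_n$ finite dimensional, and $d\in\mathbb Z$. The dual $(A_p)^*$ has degree $-p$; inside tensors it is shifted by $-1$, so a factor in $(A_p)^*$ has degree $-(p+1)$, while a factor in $A_q$ has degree $q$. In the Koszul sign rule a factor in $(A_p)^*$ has parity $p+1$ and a factor in $A_q$ has parity $q+d$ (that is, the parity of $q$ if $d$ is even). **$V_3$-algebras.** A $V_3$-algebra structure of dimension $d$ on $A$ consists of elements $v_{i_1,\dots,i_n}\in A\otimes(A^*)^{\otimes i_1}\otimes\cdots\otimes A\otimes(A^*)^{\otimes i_n}$ (understood degreewise in the tensor factors) for $1\le n\le 3$, $i_1,\dots,i_n\ge 0$, with no $v_0$, pictured as vertices of type $n$ with $n$ outgoing edges (the factors $A$) and $i_1+\dots+i_n$ incoming edges (the factors $A^*$) in cyclic order, such that: - *Degree:* $v_{i_1,\dots,i_n}$ has degree $\nu_n:=n(2-d)+(d-4)$. - *Symmetry:* $v_{i_2,\dots,i_n,i_1}=(-1)^\epsilon\,\tau(v_{i_1,\dots,i_n})$, where $\tau$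 is the cyclic rotation of the tensor factors and $(-1)^\epsilon$ the Koszul sign. - *Boundary:* for $1\le n\le 3$ and all $i_1,\dots,i_n$, $\sum_\gamma (-1)^{\epsilon}v(\gamma)=0$, the sum over all planar directed trees $\gamma$ with these external edges and exactly one internal edge $e$. Here $v(\gamma)$ is obtained by writing $e\wedge v\wedge v'$ ($e$ running from the vertex labelled $v$ to the vertex labelled $v'$, both of type at least $1$), moving the two tensor factors belonging to $e$ next to $e$, contracting them, and putting the remaining factors in their cyclic order; $\epsilon$ is the Koszul sign, an edge having parity $d+1$ and a vertex element the total parity of its factors, which is $d$. **Cyclic Hochschild complex.** Put $|a|=\deg a+1$. Let $CC^\bullet(A)=\prod_{j\ge0}\{f:A^{\otimes j+1}\to\mathbf k \mid f(a_1,\dots,a_{j+1})=(-1)^{|a_{j+1}|(|a_1|+\cdots+|a_j|)}f(a_{j+1},a_1,\dots,a_j)\}$, graded by letting $CC^m$ be the set of those $f$ that vanish on homogeneous arguments unless $\sum_i|a_i|=-m$. The type $1$ elements $\mu_l=v_l$ define $\delta:CC^m\to CC^{m-1}$, $$\delta f(a_1,\dots,a_N)=\sum(-1)^{|f|+|a_1|+\cdots+|a_{i-1}|}f(a_1,\dots,\mu_l(a_i,\dots),\dots,a_N),$$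 the sum including the terms in which the arguments of $\mu_l$ wrap around cyclically, with the corresponding Koszul signs. **Operations.** A graph with one vertex of type $n\in\{2,3\}$, whose $n$ outgoing edges end at $n$ inputs, acts on $CC^\bullet(A)$ as follows: place $f_1,\dots,f_n$ at the inputs, place $v_{i_1,\dots,i_n}$ at the vertex, contract along the edges, leave all other factors as free arguments ("hairs") in all possible planar ways, read them along the boundary, and sum over all cyclic rotations of the output (an output without arguments is dropped); the signs are the Koszul signs given by an orientation of the set consisting of the vertex $v$ and the edges. For $f\in CC^{m}$ let $[f,g]=(-1)^{dm}\cdot$(operation of the graph with one type $2$ vertex, with orientation $v\wedge e_1\wedge e_2$, $e_1$ ending at $f$ and $e_2$ at $g$). Let $H(f,g,h)$ be the sum of the operations of the two graphs (one for each cyclic order of the inputs) with one type $3$ vertex, with orientation $e_3\wedge e_2\wedge e_1\wedge v$. **Proposition.** Let $A$ be a $V_3$-algebra of dimension $d$, and let $f\in CC^{m_1}$, $g\in CC^{m_2}$, $h\in CC^{m_3}$. 1. $\delta$ maps $CC^m$ to $CC^{m-1}$ and $\delta^2=0$. Put $HC^m=\ker(\delta|_{CC^m})/\delta(CC^{m+1})$.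 2. $[f,g]\in CC^{m_1+m_2+2-d}$. The bracket is skew-symmetric, $[f,g]=-(-1)^{(m_1+d)(m_2+d)}[g,f]$, and closed, $\delta[f,g]=(-1)^{m_2+d}[\delta f,g]+[f,\delta g]$. 3. The Jacobi identity holds up to the homotopy $H$: $H(f,g,h)\in CC^{m_1+m_2+m_3+5-2d}$ and $$[f,[g,h]]-[[f,g],h]-(-1)^{(m_1+d)(m_2+d)}[g,[f,h]]=(-1)^{dm_2+m_1+m_2+m_3}\bigl(\delta H(f,g,h)-(-1)^{m_2+m_3}H(\delta f,g,h)-(-1)^{m_3}H(f,\delta g,h)-H(f,g,\delta h)\bigr).$$ 4. Consequently the bracket induces a well-defined bilinear bracket on $HC^\bullet(A)$, and $L_i:=HC^{\,i+d-2}(A)$ with this bracket $L_i\otimes L_j\to L_{i+j}$ is a graded Lie algebra. -/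

import Mathlib

universe u

noncomputable section

namespace TZ

/-- A leg of a vertex: an outgoing leg carrying an element of `A_q`, or an incoming leg carrying
an element of `(A_p)^*`. -/
inductive Leg : Type
  | out (q : ℤ) : Leg
  | inn (p : ℤ) : Leg

namespace Leg

/-- The degree of a tensor factor: `A_q` sits in degree `q` (unshifted), while `(A_p)^*` sits in
degree `-p`, shifted by `-1`. -/
def deg : Leg → ℤ
  | out q => q
  | inn p => -(p + 1)

/-- The exponent used in the Koszul sign rule. For a factor of `(A_p)^*` it is the shifted degree
`p + 1`; for a factor of `A_q` it is `q + d`, which has the parity of `q` when the dimension `d`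
is even. -/
def par (d : ℤ) : Leg → ℤ
  | out q => q + d
  | inn p => p + 1

/-- `1` for an outgoing leg, `0` for an incoming one. -/
def outs : Leg → ℕ
  | out _ => 1
  | inn _ => 0

end Leg

/-- The space of arguments that a leg is tested against: a tensor factor in `A_q` is tested
against `(A_q)^*`, a tensor factor in `(A_p)^*` is tested against `A_p`. -/
def Probe (k : Type u) [Field k] (A : ℤ → Type u) [∀ n, AddCommGroup (A n)]
    [∀ n, Module k (A n)] : Leg → Type u
  | .out q => Module.Dual k (A q)
  | .inn p => A p

section

variable (k : Type u) [Field k] (A : ℤ → Type u) [∀ n, AddCommGroup (A n)] [∀ n, Module k (A n)]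

instance instAddCommGroupProbe (l : Leg) : AddCommGroup (Probe k A l) :=
  match l with
  | .out q => inferInstanceAs (AddCommGroup (Module.Dual k (A q)))
  | .inn p => inferInstanceAs (AddCommGroup (A p))

instance instModuleProbe (l : Leg) : Module k (Probe k A l) :=
  match l with
  | .out q => inferInstanceAs (Module k (Module.Dual k (A q)))
  | .inn p => inferInstanceAs (Module k (A p))

/-- Multilinear functionals on the arguments of the word `w` of legs. As every `A_n` is finite
dimensional, this is the tensor product of the spaces `A_q` (one for each letter `out q`) and
`(A_p)^*` (one for each letter `inn p`), in the order of the word. -/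
abbrev WordTensor {L : ℕ} (w : Fin L → Leg) : Type u :=
  MultilinearMap k (fun l => Probe k A (w l)) k

/-- A family of tensors, one component for each word of legs. -/
def Tensor : Type u := ∀ (L : ℕ) (w : Fin L → Leg), WordTensor k A w

instance instAddCommGroupTensor : AddCommGroup (Tensor k A) :=
  inferInstanceAs (AddCommGroup (∀ (L : ℕ) (w : Fin L → Leg), WordTensor k A w))

instance instModuleTensor : Module k (Tensor k A) :=
  inferInstanceAs (Module k (∀ (L : ℕ) (w : Fin L → Leg), WordTensor k A w))

end

section

variable {k : Type u} [Field k] {A : ℤ → Type u} [∀ n, AddCommGroup (A n)] [∀ n, Module k (A n)]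

theorem add_apply (T T' : Tensor k A) (L : ℕ) (w : Fin L → Leg) :
    (T + T') L w = T L w + T' L w := rfl

theorem smul_apply (c : k) (T : Tensor k A) (L : ℕ) (w : Fin L → Leg) :
    (c • T) L w = c • T L w := rfl

/-- The number of outgoing legs of a word. -/
def outs {L : ℕ} (w : Fin L → Leg) : ℕ := ∑ l, (w l).outs

/-- The degree of a word. -/
def deg {L : ℕ} (w : Fin L → Leg) : ℤ := ∑ l, (w l).deg

/-- The Koszul exponent of a word. -/
def par (d : ℤ) {L : ℕ} (w : Fin L → Leg) : ℤ := ∑ l, (w l).par d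

/-- Reading the arguments in another order. -/
def reindex {L : ℕ} (w : Fin L → Leg) (e : Fin L ≃ Fin L) :
    WordTensor k A (fun l => w (e l)) →ₗ[k] WordTensor k A w where
  toFun T :=
    { toFun := fun x => T (fun l => x (e l))
      map_update_add' := by
        intro inst x i a b
        obtain rfl := Subsingleton.elim inst (instDecidableEqFin L)
        obtain ⟨j, rfl⟩ := e.surjective i
        simp only [Function.update_comp_eq_of_injective' x e.injective j]
        exact T.map_update_add _ _ _ _
      map_update_smul' := by
        intro inst x i c a
        obtain rfl := Subsingleton.elim inst (instDecidableEqFin L)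
        obtain ⟨j, rfl⟩ := e.surjective i
        simp only [Function.update_comp_eq_of_injective' x e.injective j]
        exact T.map_update_smul _ _ _ _ }
  map_add' _ _ := rfl
  map_smul' _ _ := rfl

/-- Rotation with the Koszul sign:
`(rot T)(a₀, …, aₙ) = (-1)^{|aₙ| (|a₀| + ⋯ + |aₙ₋₁|)} T(aₙ, a₀, …, aₙ₋₁)`. -/
def rot (d : ℤ) : Tensor k A →ₗ[k] Tensor k A where
  toFun T L w := match L, w with
    | 0, w => T 0 w
    | n + 1, w =>
      ((w (Fin.last n)).par d * ∑ i : Fin n, (w i.castSucc).par d).negOnePow •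
        reindex w (finRotate (n + 1)).symm (T (n + 1) (fun l => w ((finRotate (n + 1)).symm l)))
  map_add' T T' := by
    funext L w
    cases L with
    | zero => rfl
    | succ n =>
      simp only [add_apply, map_add]
      exact smul_add _ _ _
  map_smul' c T := by
    funext L w
    cases L with
    | zero => rfl
    | succ n =>
      simp only [smul_apply, map_smul, RingHom.id_apply]
      exact smul_comm _ _ _

/-- The sum of a family of tensors over all rotations of the legs. -/
def cyclicSumFun (d : ℤ) (T : Tensor k A) : Tensor k A :=
  fun L w => ∑ r ∈ Finset.range L, ((rot d ^ r) T : Tensor k A) L w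

theorem cyclicSumFun_apply (d : ℤ) (T : Tensor k A) (L : ℕ) (w : Fin L → Leg) :
    cyclicSumFun d T L w = ∑ r ∈ Finset.range L, ((rot d ^ r) T : Tensor k A) L w := rfl

/-- `cyclicSumFun` as a linear map. -/
def cyclicSum (d : ℤ) : Tensor k A →ₗ[k] Tensor k A where
  toFun := cyclicSumFun d
  map_add' T T' := by
    funext L w
    simp only [cyclicSumFun_apply, map_add, add_apply, Finset.sum_add_distrib]
  map_smul' c T := by
    funext L w
    simp only [cyclicSumFun_apply, map_smul, smul_apply, Finset.smul_sum, RingHom.id_apply]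

/-- The first `l` letters of a word (or of a tuple of arguments). -/
abbrev pre {L : ℕ} {M : Fin L → Type*} (l : Fin (L + 1)) (x : ∀ i, M i) (i : Fin l) :
    M ⟨i, by omega⟩ := x ⟨i, by omega⟩

/-- The letters of a word (or of a tuple of arguments) after the first `l`. -/
abbrev post {L : ℕ} {M : Fin L → Type*} (l : Fin (L + 1)) (x : ∀ i, M i) (i : Fin (L - l)) :
    M ⟨l + i, by omega⟩ := x ⟨l + i, by omega⟩

/-- Add a letter `c` in front of a word. -/
abbrev cons {n : ℕ} (c : Leg) (w : Fin n → Leg) : Fin (n + 1) → Leg :=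
  Fin.cons (α := fun _ => Leg) c w

/-- The functional `a ↦ Y(a, x)` on `A_q`. -/
def slot {q : ℤ} {n : ℕ} {w : Fin n → Leg} (Y : WordTensor k A (cons (.inn q) w))
    (x : ∀ i, Probe k A (w i)) : Module.Dual k (A q) where
  toFun a := Y.curryLeft a x
  map_add' a b := by
    have := Y.curryLeft.map_add a b
    exact congrArg (fun F => F x) this
  map_smul' c a := by
    have := Y.curryLeft.map_smul c a
    exact congrArg (fun F => F x) this

theorem pre_update {L : ℕ} {M : Fin L → Type*} (l : Fin (L + 1)) (x : ∀ i, M i) (j : Fin l)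
    (c : M ⟨j, by omega⟩) :
    pre l (Function.update x ⟨j, by omega⟩ c) = Function.update (pre l x) j c :=
  Function.update_comp_eq_of_injective' x
    (f := fun i : Fin l => (⟨i, by omega⟩ : Fin L)) (fun a b h => by simpa [Fin.ext_iff] using h) j c

theorem post_update {L : ℕ} {M : Fin L → Type*} (l : Fin (L + 1)) (x : ∀ i, M i)
    (j : Fin (L - l)) (c : M ⟨l + j, by omega⟩) :
    post l (Function.update x ⟨l + j, by omega⟩ c) = Function.update (post l x) j c :=
  Function.update_comp_eq_of_injective' x
    (f := fun i : Fin (L - l) => (⟨l + i, by omega⟩ : Fin L))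
    (fun a b h => by simpa [Fin.ext_iff] using h) j c

theorem pre_update_of_le {L : ℕ} {M : Fin L → Type*} (l : Fin (L + 1)) (x : ∀ i, M i) (i : Fin L)
    (h : (l : ℕ) ≤ i) (c : M i) : pre l (Function.update x i c) = pre l x :=
  funext fun j => Function.update_of_ne (fun e => by
    have := congrArg Fin.val e
    simp only at this
    omega) _ _

theorem post_update_of_lt {L : ℕ} {M : Fin L → Type*} (l : Fin (L + 1)) (x : ∀ i, M i) (i : Fin L)
    (h : (i : ℕ) < l) (c : M i) : post l (Function.update x i c) = post l x :=
  funext fun j => Function.update_of_ne (fun e => by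
    have := congrArg Fin.val e
    simp only at this
    omega) _ _

theorem slot_add {q : ℤ} {n : ℕ} {w : Fin n → Leg} (Y : WordTensor k A (cons (.inn q) w))
    (x : ∀ i, Probe k A (w i)) (j : Fin n) (a b : Probe k A (w j)) :
    slot Y (Function.update x j (a + b)) =
      slot Y (Function.update x j a) + slot Y (Function.update x j b) :=
  LinearMap.ext fun c => (Y.curryLeft c).map_update_add x j a b

theorem slot_smul {q : ℤ} {n : ℕ} {w : Fin n → Leg} (Y : WordTensor k A (cons (.inn q) w))
    (x : ∀ i, Probe k A (w i)) (j : Fin n) (c : k) (a : Probe k A (w j)) :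
    slot Y (Function.update x j (c • a)) = c • slot Y (Function.update x j a) :=
  LinearMap.ext fun b => (Y.curryLeft b).map_update_smul x j c a

/-- Contraction along one internal edge. Its source has the legs `out q, (first l letters of w)`,
its target has the legs `inn q, (remaining letters of w)`, and the leg `out q` is paired with the
leg `inn q`. -/
def contract {L : ℕ} {w : Fin L → Leg} (l : Fin (L + 1)) (q : ℤ)
    (X : WordTensor k A (cons (.out q) (pre l w))) (Y : WordTensor k A (cons (.inn q) (post l w))) :
    WordTensor k A w where
  toFun x := X.curryLeft (slot Y (post l x)) (pre l x)
  map_update_add' := by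
    intro inst x i a b
    obtain rfl := Subsingleton.elim inst (instDecidableEqFin L)
    by_cases h : (i : ℕ) < l
    · rw [post_update_of_lt l x i h, post_update_of_lt l x i h, post_update_of_lt l x i h]
      obtain ⟨i, hi⟩ := i
      have e := fun c => pre_update (M := fun i => Probe k A (w i)) l x ⟨i, h⟩ c
      simp only at e
      rw [e, e, e]
      exact (X.curryLeft _).map_update_add _ _ _ _
    · rw [pre_update_of_le l x i (by omega), pre_update_of_le l x i (by omega),
        pre_update_of_le l x i (by omega)]
      obtain ⟨i, hi⟩ := i
      simp only [not_lt] at h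
      obtain ⟨j, rfl⟩ := Nat.exists_eq_add_of_le h
      have e := post_update (M := fun i => Probe k A (w i)) l x
        (⟨j, by omega⟩ : Fin (L - (l : ℕ)))
      simp only at e
      rw [e, e, e, slot_add]
      exact congrArg (fun F => F (pre l x)) (X.curryLeft.map_add _ _)
  map_update_smul' := by
    intro inst x i c a
    obtain rfl := Subsingleton.elim inst (instDecidableEqFin L)
    by_cases h : (i : ℕ) < l
    · rw [post_update_of_lt l x i h, post_update_of_lt l x i h]
      obtain ⟨i, hi⟩ := i
      have e := fun c => pre_update (M := fun i => Probe k A (w i)) l x ⟨i, h⟩ c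
      simp only at e
      rw [e, e]
      exact (X.curryLeft _).map_update_smul _ _ _ _
    · rw [pre_update_of_le l x i (by omega), pre_update_of_le l x i (by omega)]
      obtain ⟨i, hi⟩ := i
      simp only [not_lt] at h
      obtain ⟨j, rfl⟩ := Nat.exists_eq_add_of_le h
      have e := post_update (M := fun i => Probe k A (w i)) l x
        (⟨j, by omega⟩ : Fin (L - (l : ℕ)))
      simp only at e
      rw [e, e, slot_smul]
      exact congrArg (fun F => F (pre l x)) (X.curryLeft.map_smul _ _)

theorem contract_add_left {L : ℕ} {w : Fin L → Leg} (l : Fin (L + 1)) (q : ℤ)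
    (X X' : WordTensor k A (cons (.out q) (pre l w)))
    (Y : WordTensor k A (cons (.inn q) (post l w))) :
    contract l q (X + X') Y = contract l q X Y + contract l q X' Y := rfl

theorem contract_smul_left {L : ℕ} {w : Fin L → Leg} (l : Fin (L + 1)) (q : ℤ) (c : k)
    (X : WordTensor k A (cons (.out q) (pre l w)))
    (Y : WordTensor k A (cons (.inn q) (post l w))) :
    contract l q (c • X) Y = c • contract l q X Y := rfl

theorem contract_add_right {L : ℕ} {w : Fin L → Leg} (l : Fin (L + 1)) (q : ℤ)
    (X : WordTensor k A (cons (.out q) (pre l w)))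
    (Y Y' : WordTensor k A (cons (.inn q) (post l w))) :
    contract l q X (Y + Y') = contract l q X Y + contract l q X Y' :=
  MultilinearMap.ext fun x => congrArg (fun F => F (pre l x))
    (X.curryLeft.map_add (slot Y (post l x)) (slot Y' (post l x)))

theorem contract_smul_right {L : ℕ} {w : Fin L → Leg} (l : Fin (L + 1)) (q : ℤ) (c : k)
    (X : WordTensor k A (cons (.out q) (pre l w)))
    (Y : WordTensor k A (cons (.inn q) (post l w))) :
    contract l q X (c • Y) = c • contract l q X Y :=
  MultilinearMap.ext fun x => congrArg (fun F => F (pre l x))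
    (X.curryLeft.map_smul c (slot Y (post l x)))

/-- Joining a vertex `T`, homogeneous of degree `D`, to a vertex `S` by an edge from `T` to `S`,
before cyclic symmetrization. The resulting word lists the legs of `T` that follow the internal
edge, then those of `S`. The degree `q` of the internal edge is the one that the degree `D` of `T`
forces. Moving the leg `inn q` of `S` next to the leg `out q` of `T` passes the first `l` legs;
this gives the Koszul sign. -/
def plugFun (d D : ℤ) (T S : Tensor k A) : Tensor k A :=
  fun L w => ∑ l : Fin (L + 1),
    ((D - deg (pre l w) + 1) * par d (pre l w)).negOnePow •
      contract l (D - deg (pre l w)) (T (l + 1) _) (S (L - l + 1) _)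

theorem plugFun_apply (d D : ℤ) (T S : Tensor k A) (L : ℕ) (w : Fin L → Leg) :
    plugFun d D T S L w = ∑ l : Fin (L + 1),
      ((D - deg (pre l w) + 1) * par d (pre l w)).negOnePow •
        contract l (D - deg (pre l w)) (T (l + 1) _) (S (L - l + 1) _) := rfl

/-- `plugFun` as a bilinear map. -/
def plugLinear (d D : ℤ) : Tensor k A →ₗ[k] Tensor k A →ₗ[k] Tensor k A :=
  LinearMap.mk₂ k (plugFun d D)
    (fun T T' S => by
      funext L w
      simp only [add_apply, plugFun_apply, contract_add_left, smul_add, Finset.sum_add_distrib])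
    (fun c T S => by
      funext L w
      simp only [smul_apply, plugFun_apply, contract_smul_left, Finset.smul_sum]
      exact Finset.sum_congr rfl fun _ _ => smul_comm _ _ _)
    (fun T S S' => by
      funext L w
      simp only [add_apply, plugFun_apply, contract_add_right, smul_add, Finset.sum_add_distrib])
    (fun c T S => by
      funext L w
      simp only [smul_apply, plugFun_apply, contract_smul_right, Finset.smul_sum]
      exact Finset.sum_congr rfl fun _ _ => smul_comm _ _ _)

/-- The sum over all graphs obtained by joining one outgoing leg of `T` (homogeneous of degree `D`)
to one incoming leg of `S`, the other legs being distributed in all planar ways; the orientation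
is `e ∧ T ∧ S`, where `e` is the new edge. -/
def plug (d D : ℤ) : Tensor k A →ₗ[k] Tensor k A →ₗ[k] Tensor k A :=
  (plugLinear d D).compr₂ (cyclicSum d)

/-- The part of a tensor with exactly `n` outgoing legs. -/
def ofType (n : ℕ) (T : Tensor k A) : Tensor k A :=
  fun _ w => if outs w = n then T _ w else 0

/-- The degree of a vertex of type `n` in a structure of dimension `d`. -/
def vdeg (d : ℤ) (n : ℕ) : ℤ := n * (2 - d) + (d - 4)

end

/-- A `V_K`-algebra structure of dimension `d` on the graded vector space `A`. For a word `w` that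
starts with an outgoing leg, with `n` outgoing legs followed respectively by `i₁, …, iₙ` incoming
ones, `v _ w` is the component of `v_{i₁, …, iₙ}` with the prescribed degrees of the tensor factors;
for a word that starts with an incoming leg it is the same element read from that leg on. -/
structure VAlgebra (K : ℕ∞) (d : ℤ) (k : Type u) [Field k] (A : ℤ → Type u)
    [∀ n, AddCommGroup (A n)] [∀ n, Module k (A n)] where
  /-- the elements `v_{i₁, …, iₙ}` -/
  v : Tensor k A
  /-- only vertices of type `1, …, K` occur -/
  type_le : ∀ (L : ℕ) (w : Fin L → Leg), outs w = 0 ∨ K < outs w → v L w = 0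
  /-- there is no `v_0 ∈ A` -/
  no_v_zero : ∀ w : Fin 1 → Leg, v 1 w = 0
  /-- degree condition -/
  degree : ∀ (L : ℕ) (w : Fin L → Leg), deg w ≠ vdeg d (outs w) → v L w = 0
  /-- symmetry condition -/
  symm : rot d v = v
  /-- boundary condition: the sum of all trees with exactly one internal edge and `n` outgoing
  edges vanishes; the internal edge runs from a vertex of type `r + 1` to one of type `n - r` -/
  boundary : ∀ n : ℕ, 1 ≤ n → (n : ℕ∞) ≤ K →
    ∑ r ∈ Finset.range n, plug d (vdeg d (r + 1)) (ofType (r + 1) v) (ofType (n - r) v) = 0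

section

variable {k : Type u} [Field k] {A : ℤ → Type u} [∀ n, AddCommGroup (A n)] [∀ n, Module k (A n)]

/-- The homogeneous elements of degree `m` of the cyclic Hochschild complex
`∏_j {f : A^{⊗ (j+1)} → k | f(a₁, …, a_{j+1}) = (-1)^ε f(a_{j+1}, a₁, …, a_j)}`, where
`ε = |a_{j+1}| (|a₁| + ⋯ + |a_j|)` and `|a| = deg a + 1`: families of functionals on words
without outgoing legs. (On such words `rot d` does not depend on `d`.) -/
def CC (k : Type u) [Field k] (A : ℤ → Type u) [∀ n, AddCommGroup (A n)] [∀ n, Module k (A n)]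
    (m : ℤ) : Submodule k (Tensor k A) where
  carrier := {f | (∀ (L : ℕ) (w : Fin L → Leg), L = 0 ∨ outs w ≠ 0 → f L w = 0) ∧
    (∀ (L : ℕ) (w : Fin L → Leg), deg w ≠ m → f L w = 0) ∧ rot 0 f = f}
  zero_mem' := ⟨fun _ _ _ => rfl, fun _ _ _ => rfl, map_zero _⟩
  add_mem' := fun {f g} hf hg =>
    ⟨fun L w h => by rw [add_apply, hf.1 L w h, hg.1 L w h, add_zero],
      fun L w h => by rw [add_apply, hf.2.1 L w h, hg.2.1 L w h, add_zero],
      by rw [map_add, hf.2.2, hg.2.2]⟩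
  smul_mem' := fun c f hf =>
    ⟨fun L w h => by rw [smul_apply, hf.1 L w h, smul_zero],
      fun L w h => by rw [smul_apply, hf.2.1 L w h, smul_zero],
      by rw [map_smul, hf.2.2]⟩

namespace VAlgebra

variable {K : ℕ∞} {d : ℤ} (V : VAlgebra K d k A)

/-- The differential on `CC^m`: one type `1` vertex is plugged into `f` in all possible ways. The
term `f(a₁, …, μ(a_i, …), …)` has the sign `(-1)^{|f| + |a₁| + ⋯ + |a_{i-1}|}`. -/
def delta (m : ℤ) : Tensor k A →ₗ[k] Tensor k A :=
  m.negOnePow • plug d (vdeg d 1) (ofType 1 V.v)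

/-- The operation given by the graph with one type `2` vertex `v`, whose outgoing edges
`e₁`, `e₂` end at the first and at the second input. The orientation is `v ∧ e₁ ∧ e₂`, which
equals `(-1)^{d+1} e₂ ∧ e₁ ∧ v`. The first input has degree `m`; the sign `(-1)^{dm}` is the one of
the degree shift that makes the bracket a Lie bracket of degree zero, and is trivial for even
`d`. -/
def bracket (m : ℤ) : Tensor k A →ₗ[k] Tensor k A →ₗ[k] Tensor k A :=
  (d + 1 + d * m).negOnePow •
    plug d (vdeg d 2 + m + 1) ∘ₗ plug d (vdeg d 2) (ofType 2 V.v)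

/-- The operation given by the graphs with one type `3` vertex, whose three outgoing edges end at
the three inputs (in both cyclic orders), with orientation `e₃ ∧ e₂ ∧ e₁ ∧ v`. The first two inputs
have degree `m₁` and `m₂`. -/
def homotopy (m₁ m₂ : ℤ) (f g h : Tensor k A) : Tensor k A :=
  plug d (vdeg d 3 + m₁ + 1 + m₂ + 1)
    (plug d (vdeg d 3 + m₁ + 1) (plug d (vdeg d 3) (ofType 3 V.v) f) g) h

/-- Cocycles of degree `m`. -/
def Z (m : ℤ) : Submodule k (Tensor k A) := CC k A m ⊓ LinearMap.ker (V.delta m)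

/-- Coboundaries of degree `m`; the differential has degree `-1`. -/
def B (m : ℤ) : Submodule k (Tensor k A) := (CC k A (m + 1)).map (V.delta (m + 1))

/-- Cyclic Hochschild cohomology. -/
abbrev HC (m : ℤ) : Type u := V.Z m ⧸ (V.B m).submoduleOf (V.Z m)

/-- The class of a cocycle. -/
def cls {m : ℤ} (f : Tensor k A) (hf : f ∈ V.Z m) : V.HC m := Submodule.Quotient.mk ⟨f, hf⟩

end VAlgebra

/-- The axioms of a graded Lie algebra, for a bracket of degree zero. -/
structure IsGradedLie {L : ℤ → Type u} [∀ i, AddCommGroup (L i)] [∀ i, Module k (L i)]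
    (b : ∀ i j, L i →ₗ[k] L j →ₗ[k] L (i + j)) : Prop where
  skew : ∀ i j (x : L i) (y : L j),
    DirectSum.lof k ℤ L (i + j) (b i j x y) =
      -((i * j).negOnePow • DirectSum.lof k ℤ L (j + i) (b j i y x))
  jacobi : ∀ i j l (x : L i) (y : L j) (z : L l),
    DirectSum.lof k ℤ L (i + (j + l)) (b i (j + l) x (b j l y z)) =
      DirectSum.lof k ℤ L (i + j + l) (b (i + j) l (b i j x y) z) +
        (i * j).negOnePow • DirectSum.lof k ℤ L (j + (i + l)) (b j (i + l) y (b i l x z))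

end

end TZ

end

/-!
A tensor is determined by its values on lists of letters, a letter being a leg together with an
argument for it (`ev`, `ext_ev`). On lists, joining two vertices by an edge is a signed sum over
the deconcatenations `x = u ++ v` of a list (`join`, `ev_plugFun`), and the cyclic sum evaluated
at `c :: x` is a signed sum over the deconcatenations of `x` (`cyc`, `ev_cyclicSum`). All
rearrangements of trees therefore reduce to the coassociativity of deconcatenation and to the
invariance of the cyclic sum under a rotation of two blocks (`splitSum_assoc`,
`cyc_splitSum_rotate`).

For two successive insertions this gives, up to sign, the decompositions `(F → G) → H = path +
fan` and `F → (G → H) = path + cofan` (`join_cyc_join`, `join_join_cyc`). The paths `F → G → H`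
are the same in both (`cyc_chain_eq`); in the fan, `F` has edges to `G` and to `H`, and it is
symmetric in `G`, `H` (`cyc_fan_symm`); in the cofan, `F` and `G` have edges to `H`, and it is
symmetric in `F`, `G` (`cyc_cofan_symm`). Hence the cofans cancel in the graded commutator of the
insertions of `T` and `S` into `f`, and if `f` has no outgoing legs the fans can be written as
iterated insertions: this is `plug_plug_commutator`, from which everything else is formal.

Applied to the vertices of a `V₃`-algebra and to cyclic cochains `f`, `g`, `h`, the commutator
formula turns the boundary condition for type `1` into `δ² = 0`, the one for type `2` (evaluated
on `f`, `g`) into the compatibility of `δ` with the bracket, and the one for type `3` (evaluated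
on `f`, `g`, `h`) into the Jacobi identity up to homotopy: `type_one_square`, `type_two_boundary₂`
and `type_three_boundary₃`. Trees in which a cochain or a vertex without free outgoing legs would
have to be the source of an edge vanish. The skew symmetry of the bracket is the symmetry of the
fan. As the differential is a derivation of the bracket, the bracket descends to cohomology, where
the homotopy terms become coboundaries.
-/

namespace TZ

/-! ### Sums over deconcatenations of a list -/

section Splits

variable {α M : Type*} [AddCommMonoid M]

/-- The sum of `f u v` over all ways of writing the list as a concatenation `u ++ v`. -/
def splitSum (f : List α → List α → M) : List α → M
  | [] => f [] []
  | c :: x => f [] (c :: x) + splitSum (fun u v => f (c :: u) v) x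

theorem splitSum_eq_sum_range (f : List α → List α → M) (x : List α) :
    splitSum f x = ∑ i ∈ Finset.range (x.length + 1), f (x.take i) (x.drop i) := by
  induction x generalizing f with
  | nil => simp [splitSum]
  | cons c x ih =>
    rw [splitSum, ih, List.length_cons, Finset.sum_range_succ' _ (x.length + 1), add_comm]
    simp

theorem splitSum_add (f g : List α → List α → M) (x : List α) :
    splitSum (fun u v => f u v + g u v) x = splitSum f x + splitSum g x := by
  simp only [splitSum_eq_sum_range, Finset.sum_add_distrib]

theorem splitSum_zero (x : List α) : splitSum (fun _ _ => (0 : M)) x = 0 := by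
  simp [splitSum_eq_sum_range]

theorem splitSum_sum {ι : Type*} (s : Finset ι) (f : ι → List α → List α → M) (x : List α) :
    splitSum (fun u v => ∑ i ∈ s, f i u v) x = ∑ i ∈ s, splitSum (f i) x := by
  simp only [splitSum_eq_sum_range]
  exact Finset.sum_comm

theorem splitSum_mul_left {k : Type*} [Semiring k] (c : k) (f : List α → List α → k)
    (x : List α) : splitSum (fun u v => c * f u v) x = c * splitSum f x := by
  simp only [splitSum_eq_sum_range, Finset.mul_sum]

theorem splitSum_mul_right {k : Type*} [Semiring k] (c : k) (f : List α → List α → k)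
    (x : List α) : splitSum (fun u v => f u v * c) x = splitSum f x * c := by
  simp only [splitSum_eq_sum_range, Finset.sum_mul]

theorem splitSum_comm (f : List α → List α → List α → List α → M) (x y : List α) :
    splitSum (fun u v => splitSum (f u v) y) x =
      splitSum (fun u' v' => splitSum (fun u v => f u v u' v') x) y := by
  simp only [splitSum_eq_sum_range]
  exact Finset.sum_comm

theorem splitSum_congr {f g : List α → List α → M} {x : List α}
    (h : ∀ u v, u ++ v = x → f u v = g u v) : splitSum f x = splitSum g x := by
  simp only [splitSum_eq_sum_range]
  exact Finset.sum_congr rfl fun i _ => h _ _ (List.take_append_drop i x)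

/-- A cut of `b ++ c :: a` lies either within `b`, before `c`, or within `a`, after `c`. -/
theorem splitSum_append_cons (f : List α → List α → M) (b : List α) (c : α) (a : List α) :
    splitSum f (b ++ c :: a) = splitSum (fun b₁ b₂ => f b₁ (b₂ ++ c :: a)) b +
      splitSum (fun a₁ a₂ => f (b ++ c :: a₁) a₂) a := by
  induction b generalizing f with
  | nil => rfl
  | cons e b ih =>
    rw [List.cons_append, splitSum, ih, splitSum, add_assoc]
    rfl

/-- Coassociativity of deconcatenation. -/
theorem splitSum_assoc (f : List α → List α → List α → M) (x : List α) :
    splitSum (fun u v => splitSum (fun a b => f a b v) u) x =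
      splitSum (fun a w => splitSum (fun b v => f a b v) w) x := by
  induction x generalizing f with
  | nil => rfl
  | cons c x ih =>
    simp only [splitSum, splitSum_add, ih, add_assoc]

end Splits

/-! ### Signs -/

/-- The sign `(-1)^z` of a parity `z`, as a scalar. -/
def sgn (k : Type*) [Field k] (z : ZMod 2) : k := if z = 0 then 1 else -1

section Sign

variable {k : Type*} [Field k]

theorem sgn_zero : sgn k 0 = 1 := rfl

theorem sgn_one : sgn k 1 = -1 := rfl

theorem sgn_add (y z : ZMod 2) : sgn k (y + z) = sgn k y * sgn k z := by
  have h : ∀ z : ZMod 2, z = 0 ∨ z = 1 := by decide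
  rcases h y with rfl | rfl <;> rcases h z with rfl | rfl
  · simp [sgn_zero]
  · simp [sgn_zero]
  · simp [sgn_zero]
  · rw [show (1 + 1 : ZMod 2) = 0 from rfl]; simp [sgn_zero, sgn_one]

theorem negOnePow_smul_eq_sgn {M : Type*} [AddCommGroup M] [Module k M] (n : ℤ) (x : M) :
    n.negOnePow • x = sgn k (n : ZMod 2) • x := by
  rcases Int.even_or_odd n with h | h
  · rw [Int.negOnePow_even n h, (ZMod.intCast_eq_zero_iff_even).2 h, sgn_zero, one_smul, one_smul]
  · rw [Int.negOnePow_odd n h, (ZMod.intCast_eq_one_iff_odd).2 h, sgn_one, Units.neg_smul,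
      one_smul, neg_smul, one_smul]

end Sign

/-! ### Tensors as functions on lists of letters -/

section Letters

variable (k : Type u) [Field k] (A : ℤ → Type u) [∀ n, AddCommGroup (A n)] [∀ n, Module k (A n)]

/-- A leg together with an argument that this leg can be tested against. -/
abbrev Letter : Type u := Σ l : Leg, Probe k A l

variable {A}

/-- The `i`-th vector of the basis dual to the chosen basis of `A_q`, as an argument of an
outgoing leg. -/
noncomputable def outLetter [∀ n, FiniteDimensional k (A n)] (q : ℤ)
    (i : Fin (Module.finrank k (A q))) :
    Letter k A :=
  ⟨.out q, (Module.finBasis k (A q)).coord i⟩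

/-- The `i`-th vector of the chosen basis of `A_q`, as an argument of an incoming leg. -/
noncomputable def innLetter [∀ n, FiniteDimensional k (A n)] (q : ℤ)
    (i : Fin (Module.finrank k (A q))) :
    Letter k A :=
  ⟨.inn q, Module.finBasis k (A q) i⟩

variable {k}

/-- The total Koszul parity of a list of letters. -/
def lpar (d : ℤ) (x : List (Letter k A)) : ZMod 2 := (x.map fun c => ((c.1.par d : ℤ) : ZMod 2)).sum

/-- The total degree of a list of letters. -/
def ldeg (x : List (Letter k A)) : ℤ := (x.map fun c => c.1.deg).sum

/-- The number of outgoing legs of a list of letters. -/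
def louts (x : List (Letter k A)) : ℕ := (x.map fun c => c.1.outs).sum

section

variable (d : ℤ) (x y : List (Letter k A)) (c : Letter k A)

@[simp] theorem lpar_nil : lpar d ([] : List (Letter k A)) = 0 := rfl
@[simp] theorem lpar_cons : lpar d (c :: x) = (c.1.par d : ℤ) + lpar d x := by simp [lpar]
@[simp] theorem lpar_append : lpar d (x ++ y) = lpar d x + lpar d y := by simp [lpar]
@[simp] theorem ldeg_nil : ldeg ([] : List (Letter k A)) = 0 := rfl
@[simp] theorem ldeg_cons : ldeg (c :: x) = c.1.deg + ldeg x := by simp [ldeg]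
@[simp] theorem ldeg_append : ldeg (x ++ y) = ldeg x + ldeg y := by simp [ldeg]
@[simp] theorem louts_nil : louts ([] : List (Letter k A)) = 0 := rfl
@[simp] theorem louts_cons : louts (c :: x) = c.1.outs + louts x := by simp [louts]
@[simp] theorem louts_append : louts (x ++ y) = louts x + louts y := by simp [louts]

/-- The Koszul parity of a list is determined by its degree and its number of outgoing legs. -/
theorem lpar_eq : lpar d x = (ldeg x : ZMod 2) + d * louts x := by
  induction x with
  | nil => simp
  | cons c x ih =>
    rw [lpar_cons, ih, ldeg_cons, louts_cons]
    obtain ⟨l, a⟩ := c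
    cases l with
    | out q => simp [Leg.par, Leg.deg, Leg.outs]; ring
    | inn p => simp [Leg.par, Leg.deg, Leg.outs]; ring

end

section

variable [∀ n, FiniteDimensional k (A n)] (d q : ℤ) (i : Fin (Module.finrank k (A q)))

@[simp] theorem par_outLetter : (outLetter k q i).1.par d = q + d := rfl
@[simp] theorem par_innLetter : (innLetter k q i).1.par d = q + 1 := rfl
@[simp] theorem deg_outLetter : (outLetter k q i).1.deg = q := rfl
@[simp] theorem deg_innLetter : (innLetter k q i).1.deg = -(q + 1) := rfl
@[simp] theorem outs_outLetter : (outLetter k q i).1.outs = 1 := rfl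
@[simp] theorem outs_innLetter : (innLetter k q i).1.outs = 0 := rfl

end

/-- The value of a tensor on the arguments listed in `x`. -/
def ev (T : Tensor k A) (x : List (Letter k A)) : k :=
  T x.length (fun i => (x.get i).1) (fun i => (x.get i).2)

theorem ev_ofFn (T : Tensor k A) {L : ℕ} (z : Fin L → Letter k A) :
    ev T (List.ofFn z) = T L (fun i => (z i).1) (fun i => (z i).2) :=
  congrArg (fun s : Σ n, Fin n → Letter k A => T s.1 (fun i => (s.2 i).1) (fun i => (s.2 i).2))
    (List.equivSigmaTuple.apply_symm_apply (⟨L, z⟩ : Σ n, Fin n → Letter k A))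

theorem apply_eq_ev (T : Tensor k A) {L : ℕ} (w : Fin L → Leg) (x : ∀ i, Probe k A (w i)) :
    T L w x = ev T (List.ofFn fun i => (⟨w i, x i⟩ : Letter k A)) :=
  (ev_ofFn T fun i => (⟨w i, x i⟩ : Letter k A)).symm

theorem ext_ev {T T' : Tensor k A} (h : ∀ x, ev T x = ev T' x) : T = T' := by
  funext L w
  ext x
  rw [apply_eq_ev, apply_eq_ev, h]

theorem ev_smul (c : k) (T : Tensor k A) (x) : ev (c • T) x = c * ev T x := rfl

theorem par_ofFn (d : ℤ) {L : ℕ} (z : Fin L → Letter k A) :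
    ((par d (fun i => (z i).1) : ℤ) : ZMod 2) = lpar d (List.ofFn z) := by
  simp [lpar, par, List.map_ofFn, List.sum_ofFn]

theorem deg_ofFn {L : ℕ} (z : Fin L → Letter k A) :
    deg (fun i => (z i).1) = ldeg (List.ofFn z) := by
  simp [ldeg, deg, List.map_ofFn, List.sum_ofFn]

theorem outs_ofFn {L : ℕ} (z : Fin L → Letter k A) :
    outs (fun i => (z i).1) = louts (List.ofFn z) := by
  simp [louts, outs, List.map_ofFn, List.sum_ofFn]

theorem exists_ofFn (x : List (Letter k A)) : ∃ (L : ℕ) (z : Fin L → Letter k A),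
    x = List.ofFn z := ⟨_, x.get, (List.ofFn_get x).symm⟩

theorem ev_rot_concat (d : ℤ) (T : Tensor k A) (x : List (Letter k A)) (c : Letter k A) :
    ev (rot d T) (x ++ [c]) = sgn k (c.1.par d * lpar d x) * ev T (c :: x) := by
  obtain ⟨L, z, rfl⟩ := exists_ofFn x
  have h1 : List.ofFn z ++ [c] = List.ofFn (Fin.snoc (α := fun _ => Letter k A) z c) := by
    rw [List.ofFn_succ']; simp
  have h2 : c :: List.ofFn z = List.ofFn (Fin.cons (α := fun _ => Letter k A) c z) := by
    simp [List.ofFn_succ]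
  have h3 : (fun l => (Fin.snoc (α := fun _ => Letter k A) z c) ((finRotate (L + 1)).symm l)) =
      Fin.cons (α := fun _ => Letter k A) c z := by
    rw [Fin.snoc_eq_cons_rotate]; simp
  rw [h1, h2, ev_ofFn, ← h3, ev_ofFn]
  set s : Fin (L + 1) → Letter k A := Fin.snoc (α := fun _ => Letter k A) z c with hs
  have key : rot d T (L + 1) (fun i => (s i).1) (fun i => (s i).2) =
      (((s (Fin.last L)).1.par d * ∑ i : Fin L, (s i.castSucc).1.par d).negOnePow) •
        T (L + 1) (fun l => (s ((finRotate (L + 1)).symm l)).1)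
          (fun l => (s ((finRotate (L + 1)).symm l)).2) := rfl
  rw [key, negOnePow_smul_eq_sgn (k := k), smul_eq_mul, ← par_ofFn]
  simp [hs, par]

/-- Rotating `r` times moves the last `r` letters to the front, with the Koszul sign of exchanging
two blocks. -/
theorem ev_rot_pow (d : ℤ) (T : Tensor k A) (b a : List (Letter k A)) :
    ev ((rot d ^ b.length) T) (a ++ b) = sgn k (lpar d a * lpar d b) * ev T (b ++ a) := by
  induction b using List.reverseRecOn generalizing a with
  | nil => simp [sgn_zero]
  | append_singleton b c ih =>
    rw [List.length_append, List.length_singleton, pow_succ', Module.End.mul_apply,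
      ← List.append_assoc, ev_rot_concat, ← List.cons_append, ih, ← mul_assoc, ← sgn_add]
    simp only [lpar_append, lpar_cons, lpar_nil, List.append_assoc, List.cons_append,
      List.nil_append]
    congr 2
    generalize (c.1.par d : ZMod 2) = p, lpar d a = q, lpar d b = r
    revert p q r
    decide

/-- Invariance under signed cyclic rotations, stated for the exchange of two blocks. -/
def Cyclic (d : ℤ) (F : List (Letter k A) → k) : Prop :=
  ∀ a b, F (a ++ b) = sgn k (lpar d a * lpar d b) * F (b ++ a)

theorem cyclic_ev_of_rot_eq {d : ℤ} {T : Tensor k A} (h : rot d T = T) : Cyclic d (ev T) := by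
  intro a b
  have h' : ∀ n : ℕ, (rot d ^ n) T = T := by
    intro n
    induction n with
    | zero => rfl
    | succ n ih => rw [pow_succ, Module.End.mul_apply, h, ih]
  rw [← ev_rot_pow, h']

theorem rot_eq_of_ev_concat {d : ℤ} {T : Tensor k A}
    (h : ∀ x c, ev T (x ++ [c]) = sgn k (c.1.par d * lpar d x) * ev T (c :: x)) :
    rot d T = T := by
  refine ext_ev fun x => ?_
  induction x using List.reverseRecOn with
  | nil => rfl
  | append_singleton x c _ => rw [ev_rot_concat, h]

end Letters

/-! ### Cyclic sums and contraction along an edge -/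

section Plug

variable {k : Type u} [Field k] {A : ℤ → Type u} [∀ n, AddCommGroup (A n)] [∀ n, Module k (A n)]

/-- The sum of the signed cyclic rotations of a function of lists; it is set to `0` on the empty
list. -/
def cyc (d : ℤ) (F : List (Letter k A) → k) : List (Letter k A) → k
  | [] => 0
  | c :: x => splitSum (fun a b => sgn k (lpar d b * (c.1.par d + lpar d a)) * F (b ++ c :: a)) x

theorem ev_cyclicSum (d : ℤ) (T : Tensor k A) (x : List (Letter k A)) :
    ev (cyclicSum d T) x = cyc d (ev T) x := by
  have h0 : ev (cyclicSum d T) x = ∑ r ∈ Finset.range x.length, ev ((rot d ^ r) T) x := by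
    change cyclicSumFun d T _ _ _ = _
    rw [cyclicSumFun_apply, sum_apply]
    rfl
  rw [h0]
  cases x with
  | nil => rfl
  | cons c x =>
    rw [cyc, splitSum_eq_sum_range, List.length_cons, ← Finset.sum_range_reflect]
    refine Finset.sum_congr rfl fun i hi => ?_
    have hi' : i ≤ x.length := by simpa [Nat.lt_succ_iff] using hi
    have := ev_rot_pow d T (x.drop i) (c :: x.take i)
    rw [List.length_drop, List.cons_append, List.take_append_drop] at this
    rw [show x.length + 1 - 1 - i = x.length - i by omega, this, lpar_cons, mul_comm (lpar d _)]

/-- The cyclic sum is invariant under rotation by one letter. -/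
theorem cyc_concat (d : ℤ) (F : List (Letter k A) → k) (x : List (Letter k A)) (c : Letter k A) :
    cyc d F (x ++ [c]) = sgn k (c.1.par d * lpar d x) * cyc d F (c :: x) := by
  cases x with
  | nil => simp [cyc, sgn_zero]
  | cons e y =>
    rw [List.cons_append, cyc, splitSum_append_cons, cyc, splitSum, add_comm, mul_add,
      ← splitSum_mul_left]
    congr 1
    · simp only [List.nil_append, lpar_nil, lpar_cons, lpar_append,
        zero_mul, sgn_zero, one_mul, add_zero, List.cons_append, ← mul_assoc, ← sgn_add]
      rw [mul_comm (c.1.par d : ZMod 2), CharTwo.add_self_eq_zero, sgn_zero, one_mul]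
    · refine splitSum_congr fun a b h => ?_
      subst h
      simp only [← mul_assoc, ← sgn_add, List.append_assoc, List.cons_append, List.nil_append,
        lpar_append, lpar_cons, lpar_nil]
      congr 2
      generalize (c.1.par d : ZMod 2) = p, (e.1.par d : ZMod 2) = q, lpar d a = r, lpar d b = s
      revert p q r s
      decide

theorem rot_cyclicSum (d : ℤ) (T : Tensor k A) : rot d (cyclicSum d T) = cyclicSum d T :=
  rot_eq_of_ev_concat fun x c => by simp only [ev_cyclicSum, cyc_concat]

theorem apply_cons_eq_ev (T : Tensor k A) {n : ℕ} (c : Leg) (w : Fin n → Leg) (a : Probe k A c)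
    (x : ∀ i, Probe k A (w i)) :
    T (n + 1) (cons c w) (Fin.cons (α := fun i => Probe k A (cons c w i)) a x) =
      ev T (⟨c, a⟩ :: List.ofFn fun i => (⟨w i, x i⟩ : Letter k A)) := by
  rw [apply_eq_ev, List.ofFn_succ]
  rfl

variable [∀ n, FiniteDimensional k (A n)]

/-- The contraction of `Φ` along an edge of degree `q`: the sum over a basis of `A_q` of the values
of `Φ` on a dual basis vector at the source and a basis vector at the target. -/
noncomputable def edge (q : ℤ) (Φ : Letter k A → Letter k A → k) : k :=
  ∑ i, Φ (outLetter k q i) (innLetter k q i)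

section Edge

variable {q : ℤ} {Φ Ψ : Letter k A → Letter k A → k}

theorem edge_congr (h : ∀ i, Φ (outLetter k q i) (innLetter k q i) =
    Ψ (outLetter k q i) (innLetter k q i)) : edge q Φ = edge q Ψ :=
  Finset.sum_congr rfl fun i _ => h i

theorem edge_eq_zero (h : ∀ i, Φ (outLetter k q i) (innLetter k q i) = 0) : edge q Φ = 0 :=
  Finset.sum_eq_zero fun i _ => h i

theorem edge_add : edge q (fun o ι => Φ o ι + Ψ o ι) = edge q Φ + edge q Ψ :=
  Finset.sum_add_distrib

theorem edge_mul_left (c : k) : edge q (fun o ι => c * Φ o ι) = c * edge q Φ :=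
  (Finset.mul_sum _ _ _).symm

theorem edge_mul_right (c : k) : edge q (fun o ι => Φ o ι * c) = edge q Φ * c :=
  (Finset.sum_mul _ _ _).symm

theorem edge_comm (q q' : ℤ) (Φ : Letter k A → Letter k A → Letter k A → Letter k A → k) :
    edge q (fun o ι => edge q' fun o' ι' => Φ o ι o' ι') =
      edge q' fun o' ι' => edge q fun o ι => Φ o ι o' ι' :=
  Finset.sum_comm

theorem edge_splitSum (q : ℤ)
    (Φ : Letter k A → Letter k A → List (Letter k A) → List (Letter k A) → k)
    (x : List (Letter k A)) :
    edge q (fun o ι => splitSum (Φ o ι) x) = splitSum (fun u v => edge q fun o ι => Φ o ι u v) x :=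
  (splitSum_sum _ (fun i => Φ (outLetter k q i) (innLetter k q i)) x).symm

end Edge

/-- Contraction along an edge from `F` (of degree `D`) to `G`, before cyclic symmetrization, on
the level of functions of lists. -/
noncomputable def join (d D : ℤ) (F G : List (Letter k A) → k) : List (Letter k A) → k :=
  splitSum fun u v => sgn k (((D - ldeg u : ℤ) + 1) * lpar d u) *
    edge (D - ldeg u) fun o ι => F (o :: u) * G (ι :: v)

/-- Expanding the functional inserted at the outgoing leg in the dual basis turns the contraction
into a sum of products. -/
theorem contract_eq_sum (T S : Tensor k A) {L : ℕ} (w : Fin L → Leg) (l : Fin (L + 1)) (q : ℤ)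
    (x : ∀ i, Probe k A (w i)) :
    contract l q (T (l + 1) _) (S (L - l + 1) _) x =
      ∑ i, ev T (outLetter k q i ::
          List.ofFn (pre l fun i => (⟨w i, x i⟩ : Letter k A))) *
        ev S (innLetter k q i ::
          List.ofFn (post l fun i => (⟨w i, x i⟩ : Letter k A))) := by
  let Φ : Module.Dual k (A q) →ₗ[k] k :=
    { toFun := fun ψ => (T (l + 1) (cons (.out q) (pre l w))).curryLeft ψ (pre l x)
      map_add' := fun a b => congrArg (fun F => F (pre l x))
        ((T (l + 1) (cons (.out q) (pre l w))).curryLeft.map_add a b)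
      map_smul' := fun c a => congrArg (fun F => F (pre l x))
        ((T (l + 1) (cons (.out q) (pre l w))).curryLeft.map_smul c a) }
  change Φ (slot (S (L - l + 1) _) (post l x)) = _
  rw [← Module.Basis.sum_dual_apply_smul_coord (Module.finBasis k (A q))
    (slot (S (L - l + 1) _) (post l x)), map_sum]
  refine Finset.sum_congr rfl fun i _ => ?_
  rw [map_smul, smul_eq_mul, mul_comm]
  congr 1
  · exact apply_cons_eq_ev T _ (pre l w) _ (pre l x)
  · exact apply_cons_eq_ev S _ (post l w) _ (post l x)

theorem ev_plugFun (d D : ℤ) (T S : Tensor k A) (x : List (Letter k A)) :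
    ev (plugFun d D T S) x = join d D (ev T) (ev S) x := by
  obtain ⟨L, z, rfl⟩ := exists_ofFn x
  rw [ev_ofFn, plugFun_apply, sum_apply, join, splitSum_eq_sum_range,
    List.length_ofFn, Finset.sum_range]
  refine Finset.sum_congr rfl fun l _ => ?_
  have h1 : (List.ofFn z).take l = List.ofFn (pre l z) := by
    refine List.ext_getElem (by simp; omega) fun i h h' => by simp
  have h2 : (List.ofFn z).drop l = List.ofFn (post l z) := by
    refine List.ext_getElem (by simp) fun i h h' => by simp
  rw [h1, h2, ← par_ofFn,
    ← deg_ofFn, _root_.smul_apply,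
    negOnePow_smul_eq_sgn (k := k), contract_eq_sum, smul_eq_mul]
  push_cast
  rfl

theorem ev_plug (d D : ℤ) (T S : Tensor k A) (x : List (Letter k A)) :
    ev (plug d D T S) x = cyc d (join d D (ev T) (ev S)) x := by
  have h : plug d D T S = cyclicSum d (plugFun d D T S) := rfl
  rw [h, ev_cyclicSum]
  congr 1
  funext y
  exact ev_plugFun d D T S y

end Plug

/-! ### Graphs with two internal edges -/

section TwoEdges

variable {k : Type u} [Field k] {A : ℤ → Type u} [∀ n, AddCommGroup (A n)] [∀ n, Module k (A n)]

/-- The cyclic sum does not change when the two blocks of a deconcatenation are rotated. -/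
theorem cyc_splitSum_rotate (d : ℤ) (H : List (Letter k A) → List (Letter k A) → k) :
    cyc d (splitSum H) =
      cyc d (splitSum fun u v => sgn k (lpar d u * lpar d v) * H v u) := by
  funext x
  cases x with
  | nil => rfl
  | cons c y =>
    simp only [cyc, splitSum_append_cons, mul_add, splitSum_add]
    -- Cuts before `c` on one side correspond to cuts after `c` on the other.
    rw [add_comm]
    simp only [← splitSum_mul_left]
    congr 1
    · trans splitSum (fun u v => splitSum (fun a₁ a₂ =>
        sgn k (lpar d v * c.1.par d + lpar d v * lpar d (a₁ ++ a₂)) *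
          H (v ++ c :: a₁) a₂) u) y
      · refine splitSum_congr fun u v _ => splitSum_congr fun a b h => ?_
        rw [h]
      rw [splitSum_assoc (fun a₁ a₂ v =>
        sgn k (lpar d v * c.1.par d + lpar d v * lpar d (a₁ ++ a₂)) *
          H (v ++ c :: a₁) a₂) y]
      refine splitSum_congr fun u v _ => splitSum_congr fun a b h => ?_
      subst h
      rw [← mul_assoc, ← sgn_add]
      simp only [lpar_append, lpar_cons]
      congr 2
      generalize (c.1.par d : ZMod 2) = p, lpar d u = q, lpar d a = r, lpar d b = s
      revert p q r s
      decide
    · symm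
      trans splitSum (fun u v => splitSum (fun a₁ a₂ =>
        sgn k (lpar d v * c.1.par d + lpar d v * lpar d (a₁ ++ a₂)) *
          (sgn k (lpar d (v ++ c :: a₁) * lpar d a₂) * H a₂ (v ++ c :: a₁))) u) y
      · refine splitSum_congr fun u v _ => splitSum_congr fun a b h => ?_
        rw [h]
      rw [splitSum_assoc (fun a₁ a₂ v =>
        sgn k (lpar d v * c.1.par d + lpar d v * lpar d (a₁ ++ a₂)) *
          (sgn k (lpar d (v ++ c :: a₁) * lpar d a₂) * H a₂ (v ++ c :: a₁))) y]
      refine splitSum_congr fun u v _ => splitSum_congr fun a b h => ?_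
      subst h
      rw [← mul_assoc, ← sgn_add]
      simp only [lpar_append, lpar_cons]
      congr 2
      generalize (c.1.par d : ZMod 2) = p, lpar d u = q, lpar d a = r, lpar d b = s
      revert p q r s
      decide

variable (d : ℤ) (f g : List (Letter k A) → List (Letter k A) → List (Letter k A) →
  List (Letter k A) → k)

/-- Two threefold deconcatenation sums nested as in `fan` have the same cyclic sum if their terms
agree after a rotation by two of the four blocks. -/
theorem cyc_fan_congr
    (h : ∀ a b c e, f a b c e =
      sgn k ((lpar d a + lpar d b) * (lpar d c + lpar d e)) * g c e a b) :
    cyc d (splitSum fun u v => splitSum (fun w c => splitSum (fun a b => f a b c v) w) u) =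
      cyc d (splitSum fun u v => splitSum (fun w c => splitSum (fun a b => g a b c v) w) u) := by
  have e : ∀ f : List (Letter k A) → List (Letter k A) → List (Letter k A) →
      List (Letter k A) → k,
      (splitSum fun u v => splitSum (fun w c => splitSum (fun a b => f a b c v) w) u) =
        splitSum fun u v => splitSum (fun c e => splitSum (fun a b => f a b c e) u) v :=
    fun f => funext fun x => splitSum_assoc
      (fun w c v => splitSum (fun a b => f a b c v) w) x
  rw [e, e, cyc_splitSum_rotate]
  congr 2
  funext u v
  rw [splitSum_comm, ← splitSum_mul_left]
  refine splitSum_congr fun a b hv => ?_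
  rw [← splitSum_mul_left]
  refine splitSum_congr fun c e hu => ?_
  subst hu hv
  rw [h, ← mul_assoc, ← sgn_add, lpar_append, lpar_append, mul_comm (lpar d c + lpar d e),
    CharTwo.add_self_eq_zero, sgn_zero, one_mul]

/-- The analogue of `cyc_fan_congr` for sums nested as in `cofan`. -/
theorem cyc_cofan_congr
    (h : ∀ a b c e, f a b c e =
      sgn k ((lpar d a + lpar d b) * (lpar d c + lpar d e)) * g c e a b) :
    cyc d (splitSum fun u v => splitSum (fun a w => splitSum (fun b c => f u a b c) w) v) =
      cyc d (splitSum fun u v => splitSum (fun a w => splitSum (fun b c => g u a b c) w) v) := by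
  have e : ∀ f : List (Letter k A) → List (Letter k A) → List (Letter k A) →
      List (Letter k A) → k,
      (splitSum fun u v => splitSum (fun a w => splitSum (fun b c => f u a b c) w) v) =
        splitSum fun u v => splitSum (fun a b => splitSum (fun c e => f a b c e) v) u :=
    fun f => funext fun x => (splitSum_assoc
      (fun u a w => splitSum (fun b c => f u a b c) w) x).symm
  rw [e, e, cyc_splitSum_rotate]
  congr 2
  funext u v
  rw [splitSum_comm, ← splitSum_mul_left]
  refine splitSum_congr fun a b hv => ?_
  rw [← splitSum_mul_left]
  refine splitSum_congr fun c e hu => ?_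
  subst hu hv
  rw [h, ← mul_assoc, ← sgn_add, lpar_append, lpar_append, mul_comm (lpar d c + lpar d e),
    CharTwo.add_self_eq_zero, sgn_zero, one_mul]

/-- A sum nested as in `chain` and one nested as in `chain'` have the same cyclic sum if their terms
agree after a rotation by one of the four blocks. -/
theorem cyc_chain_congr
    (h : ∀ a b c e, f a b c e =
      sgn k (lpar d a * (lpar d b + lpar d c + lpar d e)) * g b c e a) :
    cyc d (splitSum fun u v => splitSum (fun a w => splitSum (fun b c => f a b c v) w) u) =
      cyc d (splitSum fun u v => splitSum (fun w e => splitSum (fun b c => g u b c e) w) v) := by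
  have e₁ : (splitSum fun u v => splitSum (fun a w => splitSum (fun b c => f a b c v) w) u) =
      splitSum fun a v => splitSum (fun b w => splitSum (fun c e => f a b c e) w) v := by
    funext x
    rw [splitSum_assoc (fun a w v => splitSum (fun b c => f a b c v) w) x]
    exact splitSum_congr fun a v _ => splitSum_assoc (f a) v
  have e₂ : (splitSum fun u v => splitSum (fun w e => splitSum (fun b c => g u b c e) w) v) =
      splitSum fun v a => splitSum (fun b w => splitSum (fun c e => g b c e a) w) v := by
    funext x
    rw [splitSum_assoc (fun b w a => splitSum (fun c e => g b c e a) w) x]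
  rw [e₁, e₂, cyc_splitSum_rotate]
  congr 2
  funext u v
  rw [← splitSum_mul_left]
  refine splitSum_congr fun a w hu => ?_
  rw [← splitSum_mul_left]
  refine splitSum_congr fun b c hw => ?_
  subst hw hu
  rw [h, ← mul_assoc, ← sgn_add, lpar_append, lpar_append, ← add_assoc, mul_comm (lpar d v),
    CharTwo.add_self_eq_zero, sgn_zero, one_mul]

variable [∀ n, FiniteDimensional k (A n)]

/-- A distinguished letter `c` of the joined graph belongs either to the target `G` or to the source
`F` of the edge. -/
theorem cyc_join_cons (D : ℤ) (F G : List (Letter k A) → k) (c : Letter k A)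
    (x : List (Letter k A)) :
    cyc d (join d D F G) (c :: x) = splitSum (fun a b =>
      splitSum (fun b₁ b₂ => sgn k (lpar d b * (c.1.par d + lpar d a) +
          ((D - ldeg b₁ : ℤ) + 1) * lpar d b₁) *
        edge (D - ldeg b₁) fun o ι => F (o :: b₁) * G (ι :: (b₂ ++ c :: a))) b +
      splitSum (fun a₁ a₂ => sgn k (lpar d b * (c.1.par d + lpar d a) +
          ((D - (ldeg b + (c.1.deg + ldeg a₁)) : ℤ) + 1) *
            (lpar d b + (c.1.par d + lpar d a₁))) *
        edge (D - (ldeg b + (c.1.deg + ldeg a₁))) fun o ι =>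
          F (o :: (b ++ c :: a₁)) * G (ι :: a₂)) a) x := by
  simp only [cyc, join, splitSum_append_cons, mul_add (sgn k _), ← splitSum_mul_left, sgn_add,
    mul_assoc, ldeg_append, ldeg_cons, lpar_append, lpar_cons]

section Terms

variable (F G H : List (Letter k A) → k) (q q' : ℤ) (a b c e : List (Letter k A))

/-- The contribution of two edges with a common source `F`, ending at `G` and at `H`, to the word
`a ++ b ++ c ++ e`. -/
noncomputable def fanTerm : k :=
  sgn k ((q + 1) * (lpar d a + lpar d b + lpar d c) + (lpar d c * (q + d + (lpar d a + lpar d b)) +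
      (q' + 1) * (lpar d c + (q + d + lpar d a)))) *
    edge q fun o ι => edge q' fun o' ι' => F (o' :: (c ++ o :: a)) * G (ι' :: b) * H (ι :: e)

/-- The contribution of a path `F → G → H` to the word `a ++ b ++ c ++ e`, cut open between the
two blocks that belong to `G`. -/
noncomputable def chainTerm : k :=
  sgn k ((q + 1) * (lpar d a + (lpar d b + lpar d c)) +
      ((lpar d b + lpar d c) * (q + d + lpar d a) + (q' + 1) * lpar d b)) *
    edge q fun o ι => edge q' fun o' ι' => F (o' :: b) * G (ι' :: (c ++ o :: a)) * H (ι :: e)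

/-- The contribution of a path `F → G → H` to the word `a ++ b ++ c ++ e`, cut open at the block
that belongs to `F`. -/
noncomputable def chainTerm' : k :=
  sgn k ((q + 1) * lpar d a + (lpar d e * (q + 1 + (lpar d b + lpar d c)) +
      (q' + 1) * (lpar d e + (q + 1 + lpar d b)))) *
    edge q fun o ι => edge q' fun o' ι' => F (o :: a) * G (o' :: (e ++ ι :: b)) * H (ι' :: c)

/-- The contribution of two edges with a common target `H`, starting at `F` and at `G`, to the word
`a ++ b ++ c ++ e`. -/
noncomputable def cofanTerm : k :=
  sgn k ((q + 1) * lpar d a + ((lpar d c + lpar d e) * (q + 1 + lpar d b) +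
      (q' + 1) * lpar d c)) *
    edge q fun o ι => edge q' fun o' ι' => F (o :: a) * G (o' :: c) * H (ι' :: (e ++ ι :: b))

end Terms

/-- The sum of all trees in which `F` (of degree `D`) has edges to `G` and to `H`; `P` is the
degree of the tree made of `F` and `G`. As for the following three sums, the cyclic symmetrization
is not included. -/
noncomputable def fan (D P : ℤ) (F G H : List (Letter k A) → k) : List (Letter k A) → k :=
  splitSum fun u v => splitSum (fun w c => splitSum (fun a b =>
    fanTerm d F G H (P - (ldeg a + ldeg b + ldeg c))
      (D - (ldeg c + (P - (ldeg a + ldeg b + ldeg c) + ldeg a))) a b c v) w) u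

/-- The sum of all paths `F → G → H`, as they occur in the insertion of `F → G` into `H`. -/
noncomputable def chain (D P : ℤ) (F G H : List (Letter k A) → k) : List (Letter k A) → k :=
  splitSum fun u v => splitSum (fun a w => splitSum (fun b c =>
    chainTerm d F G H (P - (ldeg a + (ldeg b + ldeg c))) (D - ldeg b) a b c v) w) u

/-- The sum of all paths `F → G → H`, as they occur in the insertion of `F` into `G → H`. -/
noncomputable def chain' (D E : ℤ) (F G H : List (Letter k A) → k) : List (Letter k A) → k :=
  splitSum fun u v => splitSum (fun w e => splitSum (fun b c =>
    chainTerm' d F G H (D - ldeg u) (E - (ldeg e + (-(D - ldeg u + 1) + ldeg b))) u b c e) w) v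

/-- The sum of all trees in which `F` (of degree `D`) and `G` (of degree `E`) both have an edge to
`H`. -/
noncomputable def cofan (D E : ℤ) (F G H : List (Letter k A) → k) : List (Letter k A) → k :=
  splitSum fun u v => splitSum (fun a w => splitSum (fun b c =>
    cofanTerm d F G H (D - ldeg u) (E - ldeg b) u a b c) w) v

/-- In `(F → G) → H` the new edge starts at `G` or at `F`. -/
theorem join_cyc_join (D P : ℤ) (F G H : List (Letter k A) → k) :
    join d P (cyc d (join d D F G)) H = chain d D P F G H + fan d D P F G H := by
  funext x
  rw [join, Pi.add_apply, chain, fan, ← splitSum_add]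
  refine splitSum_congr fun u v _ => ?_
  rw [← splitSum_add]
  trans sgn k (((P - ldeg u : ℤ) + 1) * lpar d u) * edge (P - ldeg u) fun o ι =>
    splitSum (fun a b =>
      splitSum (fun b₁ b₂ => sgn k (lpar d b * ((P - ldeg u : ℤ) + d + lpar d a) +
          ((D - ldeg b₁ : ℤ) + 1) * lpar d b₁) *
        edge (D - ldeg b₁) fun o' ι' => F (o' :: b₁) * G (ι' :: (b₂ ++ o :: a)) * H (ι :: v)) b +
      splitSum (fun a₁ a₂ => sgn k (lpar d b * ((P - ldeg u : ℤ) + d + lpar d a) +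
          ((D - (ldeg b + (P - ldeg u + ldeg a₁)) : ℤ) + 1) *
            (lpar d b + ((P - ldeg u : ℤ) + d + lpar d a₁))) *
        edge (D - (ldeg b + (P - ldeg u + ldeg a₁))) fun o' ι' =>
          F (o' :: (b ++ o :: a₁)) * G (ι' :: a₂) * H (ι :: v)) a) u
  · congr 1
    refine edge_congr fun i => ?_
    rw [cyc_join_cons]
    simp only [par_outLetter, deg_outLetter, ← splitSum_mul_right, add_mul (splitSum _ _),
      mul_assoc (sgn k _), ← edge_mul_right]
    push_cast
    rfl
  · simp only [edge_splitSum, edge_add, ← splitSum_mul_left, mul_add (sgn k _), edge_mul_left]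
    refine splitSum_congr fun a b h => ?_
    subst h
    congr 1
    · refine splitSum_congr fun b₁ b₂ h => ?_
      subst h
      rw [← mul_assoc, ← sgn_add]
      simp only [chainTerm, ldeg_append, lpar_append]
    · refine splitSum_congr fun a₁ a₂ h => ?_
      subst h
      rw [← mul_assoc, ← sgn_add]
      simp only [fanTerm, ldeg_append, lpar_append]

/-- In `F → (G → H)` the new edge ends at `H` or at `G`. -/
theorem join_join_cyc (D E : ℤ) (F G H : List (Letter k A) → k) :
    join d D F (cyc d (join d E G H)) = cofan d D E F G H + chain' d D E F G H := by
  funext x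
  rw [join, Pi.add_apply, chain', cofan, ← splitSum_add]
  refine splitSum_congr fun u v _ => ?_
  rw [← splitSum_add]
  trans sgn k (((D - ldeg u : ℤ) + 1) * lpar d u) * edge (D - ldeg u) fun o ι =>
    splitSum (fun a b =>
      splitSum (fun b₁ b₂ => sgn k (lpar d b * ((D - ldeg u : ℤ) + 1 + lpar d a) +
          ((E - ldeg b₁ : ℤ) + 1) * lpar d b₁) *
        edge (E - ldeg b₁) fun o' ι' => F (o :: u) * G (o' :: b₁) * H (ι' :: (b₂ ++ ι :: a))) b +
      splitSum (fun a₁ a₂ => sgn k (lpar d b * ((D - ldeg u : ℤ) + 1 + lpar d a) +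
          ((E - (ldeg b + (-(D - ldeg u + 1) + ldeg a₁)) : ℤ) + 1) *
            (lpar d b + ((D - ldeg u : ℤ) + 1 + lpar d a₁))) *
        edge (E - (ldeg b + (-(D - ldeg u + 1) + ldeg a₁))) fun o' ι' =>
          F (o :: u) * G (o' :: (b ++ ι :: a₁)) * H (ι' :: a₂)) a) v
  · congr 1
    refine edge_congr fun i => ?_
    rw [cyc_join_cons]
    simp only [par_innLetter, deg_innLetter, ← splitSum_mul_left, mul_add (F _),
      mul_left_comm (F _) (sgn k _), ← edge_mul_left, mul_assoc (F _)]
    push_cast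
    rfl
  · simp only [edge_splitSum, edge_add, ← splitSum_mul_left, mul_add (sgn k _), edge_mul_left]
    refine splitSum_congr fun a b h => ?_
    subst h
    congr 1
    · refine splitSum_congr fun b₁ b₂ h => ?_
      subst h
      rw [← mul_assoc, ← sgn_add]
      simp only [cofanTerm, lpar_append]
    · refine splitSum_congr fun a₁ a₂ h => ?_
      subst h
      rw [← mul_assoc, ← sgn_add]
      simp only [chainTerm', lpar_append]

end TwoEdges
/-! ### Symmetries of graphs with two internal edges -/

section Symmetry

variable {k : Type u} [Field k] {A : ℤ → Type u} [∀ n, AddCommGroup (A n)] [∀ n, Module k (A n)]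

/-- Homogeneity: `F` is supported on words of degree `D` with `n` outgoing legs. -/
structure Homog (D : ℤ) (n : ℕ) (F : List (Letter k A) → k) : Prop where
  deg : ∀ x, F x ≠ 0 → ldeg x = D
  outs : ∀ x, F x ≠ 0 → louts x = n

theorem Homog.par (d : ℤ) {D : ℤ} {n : ℕ} {F : List (Letter k A) → k} (hF : Homog D n F)
    (x : List (Letter k A)) (hx : F x ≠ 0) : lpar d x = D + d * n := by
  rw [lpar_eq, hF.deg x hx, hF.outs x hx]

/-- Two signed products agree if their signs agree whenever the product does not vanish; the latter
condition provides the parities of the factors. -/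
theorem sgn_mul_congr {r r' s s' t : ZMod 2} {x y : k} (hx : x = sgn k r' * y)
    (h : y ≠ 0 → r + r' = s + s' + t) :
    sgn k r * x = sgn k s * (sgn k s' * (sgn k t * y)) := by
  by_cases hy : y = 0
  · simp [hx, hy]
  · rw [hx, ← mul_assoc, ← sgn_add, h hy, sgn_add, sgn_add, mul_assoc, mul_assoc]

theorem cyc_mul (d : ℤ) (c : k) (F : List (Letter k A) → k) :
    cyc d (fun x => c * F x) = fun x => c * cyc d F x := by
  funext x
  cases x with
  | nil => simp [cyc]
  | cons e x => simp only [cyc, mul_left_comm _ c, splitSum_mul_left]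

theorem cyc_add (d : ℤ) (F G : List (Letter k A) → k) :
    cyc d (F + G) = cyc d F + cyc d G := by
  funext x
  cases x with
  | nil => simp [cyc]
  | cons e x => simp only [cyc, Pi.add_apply, mul_add (sgn k _), splitSum_add]

theorem cyc_zero (d : ℤ) : cyc d (0 : List (Letter k A) → k) = 0 := by
  funext x
  cases x with
  | nil => rfl
  | cons e x => simp only [cyc, Pi.zero_apply, mul_zero, splitSum_zero]

theorem Homog.cyc {D : ℤ} {m : ℕ} {F : List (Letter k A) → k} {d : ℤ}
    (hF : Homog D m F) : Homog D m (cyc d F) := by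
  have key : ∀ x, TZ.cyc d F x ≠ 0 → ldeg x = D ∧ louts x = m := by
    intro x hx
    by_contra hc
    refine hx ?_
    cases x with
    | nil => rfl
    | cons c x =>
      refine (splitSum_congr fun u v h => ?_).trans (splitSum_zero x)
      by_contra h0
      have h1 := hF.outs _ (right_ne_zero_of_mul h0)
      have h2 := hF.deg _ (right_ne_zero_of_mul h0)
      subst h
      simp only [louts_cons, louts_append, ldeg_cons, ldeg_append] at *
      omega
  exact ⟨fun x hx => (key x hx).1, fun x hx => (key x hx).2⟩

variable [∀ n, FiniteDimensional k (A n)] (d : ℤ) {F G H : List (Letter k A) → k}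

/-- The sign consists of the exchange of the two edges, of parity `d + 1`, and of `G` and `H`. -/
theorem fanTerm_symm {g h : ZMod 2} (hF : Cyclic d F) (hG : ∀ x, G x ≠ 0 → lpar d x = g)
    (hH : ∀ x, H x ≠ 0 → lpar d x = h) (q q' : ℤ) (a b c e : List (Letter k A)) :
    fanTerm d F G H q q' a b c e = sgn k ((lpar d a + lpar d b) * (lpar d c + lpar d e)) *
      (sgn k (d + 1 + g * h) * fanTerm d F H G q' q c e a b) := by
  rw [fanTerm, fanTerm, edge_comm q' q]
  simp only [← edge_mul_left]
  refine edge_congr fun i => edge_congr fun j => ?_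
  have e₁ := hF (outLetter k q' j :: c) (outLetter k q i :: a)
  simp only [List.cons_append] at e₁
  refine sgn_mul_congr (by rw [e₁]; ring) fun h0 => ?_
  have hg := hG _ (right_ne_zero_of_mul h0)
  have hh := hH _ (right_ne_zero_of_mul (left_ne_zero_of_mul h0))
  subst hg hh
  simp only [lpar_cons, par_outLetter, par_innLetter]
  push_cast
  generalize (q : ZMod 2) = q, (q' : ZMod 2) = q', (d : ZMod 2) = d', lpar d a = a, lpar d b = b,
    lpar d c = c, lpar d e = e
  revert q q' d' a b c e
  decide

/-- Exchanging `F` and `G` together with their edges. -/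
theorem cofanTerm_symm {f g : ZMod 2} (hF : ∀ x, F x ≠ 0 → lpar d x = f)
    (hG : ∀ x, G x ≠ 0 → lpar d x = g) (hH : Cyclic d H) (q q' : ℤ)
    (a b c e : List (Letter k A)) :
    cofanTerm d F G H q q' a b c e = sgn k ((lpar d a + lpar d b) * (lpar d c + lpar d e)) *
      (sgn k ((f + d + 1) * (g + d + 1)) * cofanTerm d G F H q' q c e a b) := by
  rw [cofanTerm, cofanTerm, edge_comm q' q]
  simp only [← edge_mul_left]
  refine edge_congr fun i => edge_congr fun j => ?_
  have e₁ := hH (innLetter k q' j :: e) (innLetter k q i :: b)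
  simp only [List.cons_append] at e₁
  refine sgn_mul_congr (by rw [e₁]; ring) fun h0 => ?_
  have hf := hF _ (right_ne_zero_of_mul (left_ne_zero_of_mul h0))
  have hg := hG _ (left_ne_zero_of_mul (left_ne_zero_of_mul h0))
  subst hf hg
  simp only [lpar_cons, par_outLetter, par_innLetter]
  push_cast
  generalize (q : ZMod 2) = q, (q' : ZMod 2) = q', (d : ZMod 2) = d', lpar d a = a, lpar d b = b,
    lpar d c = c, lpar d e = e
  revert q q' d' a b c e
  decide

/-- The sign moves the edge `G → H` past `F` and past the edge `F → G`. -/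
theorem chainTerm_eq {f : ZMod 2} (hF : ∀ x, F x ≠ 0 → lpar d x = f) (hG : Cyclic d G) (q q' : ℤ)
    (a b c e : List (Letter k A)) :
    chainTerm d F G H q q' a b c e = sgn k (lpar d a * (lpar d b + lpar d c + lpar d e)) *
      (sgn k ((d + 1) * (f + 1)) * chainTerm' d F G H q' q b c e a) := by
  rw [chainTerm, chainTerm', edge_comm q' q]
  simp only [← edge_mul_left]
  refine edge_congr fun i => edge_congr fun j => ?_
  have e₁ := hG (innLetter k q' j :: c) (outLetter k q i :: a)
  simp only [List.cons_append] at e₁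
  refine sgn_mul_congr (by rw [e₁]; ring) fun h0 => ?_
  have hf := hF _ (left_ne_zero_of_mul (left_ne_zero_of_mul h0))
  subst hf
  simp only [lpar_cons, par_outLetter, par_innLetter]
  push_cast
  generalize (q : ZMod 2) = q, (q' : ZMod 2) = q', (d : ZMod 2) = d', lpar d a = a, lpar d b = b,
    lpar d c = c, lpar d e = e
  revert q q' d' a b c e
  decide

section Homogeneous

variable {D E M P P' : ℤ} {m n r : ℕ}

theorem cyc_fan_symm (hF : Cyclic d F) (hG : Homog E n G) (hH : Homog M r H)
    (hP : P = D + E + 1) (hP' : P' = D + M + 1) :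
    cyc d (fan d D P F G H) = fun x =>
      sgn k (d + 1 + (E + d * n) * (M + d * r)) * cyc d (fan d D P' F H G) x := by
  rw [← cyc_mul, fan, fan]
  simp only [← splitSum_mul_left]
  refine cyc_fan_congr d _ _ fun a b c e => ?_
  subst hP hP'
  -- The two expressions for the degrees of the edges agree when the total degree is the one of the
  -- tree; otherwise both terms vanish.
  by_cases ht : ldeg a + ldeg b + ldeg c + ldeg e = D + E + M + 2
  · rw [fanTerm_symm d hF (hG.par d) (hH.par d)]
    congr 3
    · linarith
    · linarith
  · rw [fanTerm, fanTerm, edge_eq_zero, edge_eq_zero]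
    · simp
    · refine fun i => edge_eq_zero fun j => ?_
      by_contra h0
      have := hH.deg _ (right_ne_zero_of_mul (left_ne_zero_of_mul h0))
      have := hG.deg _ (right_ne_zero_of_mul h0)
      simp only [ldeg_cons, deg_innLetter] at *
      omega
    · refine fun i => edge_eq_zero fun j => ?_
      by_contra h0
      have := hH.deg _ (right_ne_zero_of_mul h0)
      simp only [ldeg_cons, deg_innLetter] at *
      omega

theorem cyc_cofan_symm (hF : Homog D m F) (hG : Homog E n G) (hH : Cyclic d H) :
    cyc d (cofan d D E F G H) = fun x =>
      sgn k ((D + d * m + d + 1) * (E + d * n + d + 1)) * cyc d (cofan d E D G F H) x := by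
  rw [← cyc_mul, cofan, cofan]
  simp only [← splitSum_mul_left]
  refine cyc_cofan_congr d _ _ fun a b c e => ?_
  rw [cofanTerm_symm d (hF.par d) (hG.par d) hH]

theorem cyc_chain_eq (hF : Homog D m F) (hG : Cyclic d G) (hP : P = D + E + 1) :
    cyc d (chain d D P F G H) = fun x =>
      sgn k ((d + 1) * (D + d * m + 1)) * cyc d (chain' d D E F G H) x := by
  rw [← cyc_mul, chain, chain']
  simp only [← splitSum_mul_left]
  refine cyc_chain_congr d _ _ fun a b c e => ?_
  rw [chainTerm_eq d (hF.par d) hG]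
  congr 3
  subst hP
  linarith

/-- No path passes through a vertex without outgoing legs. -/
theorem chain_eq_zero (hG : Homog E 0 G) : chain d D P F G H = 0 := by
  have h : ∀ q q' a b c e, chainTerm d F G H q q' a b c e = 0 := fun q q' a b c e => by
    rw [chainTerm, edge_eq_zero, mul_zero]
    refine fun i => edge_eq_zero fun j => ?_
    by_contra h0
    have := hG.outs _ (right_ne_zero_of_mul (left_ne_zero_of_mul h0))
    simp only [louts_cons, louts_append, outs_outLetter] at this
    omega
  funext x
  simp only [chain, h, splitSum_zero, Pi.zero_apply]

theorem join_eq_zero (hF : Homog D 0 F) : join d D F G = 0 := by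
  funext x
  refine (splitSum_congr fun u v _ => ?_).trans (splitSum_zero x)
  rw [edge_eq_zero, mul_zero]
  intro i
  by_contra h0
  have := hF.outs _ (left_ne_zero_of_mul h0)
  simp only [louts_cons, outs_outLetter] at this
  omega

/-- The truncated subtraction is harmless: the tree vanishes if `m = 0`. -/
theorem Homog.join (hF : Homog D m F) (hG : Homog E n G) :
    Homog (D + E + 1) (m + n - 1) (join d D F G) := by
  have key : ∀ x, TZ.join d D F G x ≠ 0 → ldeg x = D + E + 1 ∧ louts x = m + n - 1 := by
    intro x hx
    by_contra hc
    refine hx ((splitSum_congr fun u v h => ?_).trans (splitSum_zero x))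
    rw [edge_eq_zero, mul_zero]
    intro i
    by_contra h0
    have h1 := hF.outs _ (left_ne_zero_of_mul h0)
    have h2 := hG.outs _ (right_ne_zero_of_mul h0)
    have h3 := hG.deg _ (right_ne_zero_of_mul h0)
    subst h
    simp only [louts_cons, louts_append, ldeg_cons, ldeg_append, outs_outLetter, outs_innLetter,
      deg_innLetter] at *
    omega
  exact ⟨fun x hx => (key x hx).1, fun x hx => (key x hx).2⟩

end Homogeneous

end Symmetry
/-! ### Insertion of cyclically invariant homogeneous tensors -/

section CycHom

variable {k : Type u} [Field k] {A : ℤ → Type u} [∀ n, AddCommGroup (A n)] [∀ n, Module k (A n)]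

/-- Cyclically invariant tensors of degree `D` all of whose words have `n` outgoing legs. -/
structure CycHom (d D : ℤ) (n : ℕ) (T : Tensor k A) : Prop where
  rot : TZ.rot d T = T
  homog : Homog D n (ev T)

theorem ev_sub (T T' : Tensor k A) (x) : ev (T - T') x = ev T x - ev T' x := rfl

theorem CycHom.cyclic {d D : ℤ} {n : ℕ} {T : Tensor k A} (hT : CycHom d D n T) :
    Cyclic d (ev T) := cyclic_ev_of_rot_eq hT.rot

theorem ev_ofType (n : ℕ) (T : Tensor k A) (x : List (Letter k A)) :
    ev (ofType n T) x = if louts x = n then ev T x else 0 := by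
  obtain ⟨L, z, rfl⟩ := exists_ofFn x
  rw [ev_ofFn, ev_ofFn, ← outs_ofFn, ofType]
  split_ifs <;> rfl

theorem VAlgebra.cycHom_ofType {K : ℕ∞} {d : ℤ} (V : VAlgebra K d k A) (n : ℕ) :
    CycHom d (vdeg d n) n (ofType n V.v) := by
  refine ⟨rot_eq_of_ev_concat fun x c => ?_, ⟨fun x hx => ?_, fun x hx => ?_⟩⟩
  · have := ev_rot_concat d V.v x c
    rw [V.symm] at this
    simp only [ev_ofType, louts_append, louts_cons, louts_nil, add_zero, add_comm (louts x), this]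
    split_ifs <;> simp
  · rw [ev_ofType] at hx
    obtain ⟨L, z, rfl⟩ := exists_ofFn x
    obtain ⟨h1, h2⟩ := ite_ne_right_iff.1 hx
    by_contra hc
    rw [← outs_ofFn] at h1
    rw [← deg_ofFn, ← h1] at hc
    rw [ev_ofFn, V.degree _ _ hc] at h2
    exact h2 rfl
  · rw [ev_ofType] at hx
    exact (ite_ne_right_iff.1 hx).1

/-- On words without outgoing legs the rotation does not depend on the dimension. -/
theorem rot_eq_rot_of_homog {d d' m : ℤ} {f : Tensor k A} (hf : Homog m 0 (ev f)) :
    rot d f = rot d' f := by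
  refine ext_ev fun x => ?_
  induction x using List.reverseRecOn with
  | nil => rfl
  | append_singleton x c _ =>
    rw [ev_rot_concat, ev_rot_concat]
    by_cases h : ev f (c :: x) = 0
    · rw [h, mul_zero, mul_zero]
    · have h1 := hf.outs _ h
      rw [louts_cons, Nat.add_eq_zero_iff] at h1
      have h2 : ∀ d : ℤ, ((c.1.par d : ℤ) : ZMod 2) = (c.1.deg : ZMod 2) := fun d => by
        have := lpar_eq d [c]
        simpa [h1.1] using this
      rw [lpar_eq, lpar_eq, h1.2, h2, h2]
      simp

theorem mem_CC_iff (d : ℤ) {m : ℤ} {f : Tensor k A} :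
    f ∈ CC k A m ↔ CycHom d m 0 f ∧ ev f [] = 0 := by
  constructor
  · rintro ⟨h1, h2, h3⟩
    have hh : Homog m 0 (ev f) := by
      refine ⟨fun x hx => ?_, fun x hx => ?_⟩ <;> obtain ⟨L, z, rfl⟩ := exists_ofFn x <;>
        by_contra hc
      · rw [ev_ofFn, h2 _ _ (by rwa [deg_ofFn])] at hx
        exact hx rfl
      · rw [ev_ofFn, h1 _ _ (Or.inr (by rwa [outs_ofFn]))] at hx
        exact hx rfl
    refine ⟨⟨(rot_eq_rot_of_homog hh).trans h3, hh⟩, ?_⟩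
    change f 0 _ _ = 0
    rw [h1 _ _ (Or.inl rfl)]
    rfl
  · rintro ⟨h, h0⟩
    refine ⟨fun L w hw => ?_, fun L w hw => ?_, (rot_eq_rot_of_homog h.homog).trans h.rot⟩
    · ext x
      rw [apply_eq_ev]
      by_contra hc
      rcases hw with rfl | hw
      · exact hc h0
      · exact hw ((outs_ofFn _).trans (h.homog.outs _ hc))
    · ext x
      rw [apply_eq_ev]
      by_contra hc
      exact hw ((deg_ofFn _).trans (h.homog.deg _ hc))

variable [∀ n, FiniteDimensional k (A n)] {d D E M P Q : ℤ} {m n r : ℕ} {T S f g : Tensor k A}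

theorem ev_plug' (d D : ℤ) (T S : Tensor k A) :
    ev (plug d D T S) = cyc d (join d D (ev T) (ev S)) := funext (ev_plug d D T S)

theorem CycHom.plug (hT : CycHom d D m T) (hS : CycHom d E n S) (hP : P = D + E + 1)
    (hr : r = m + n - 1) : CycHom d P r (plug d D T S) := by
  subst hP hr
  refine ⟨rot_cyclicSum d _, ?_⟩
  rw [ev_plug']
  exact (hT.homog.join d hS.homog).cyc

theorem plug_mem_CC (hT : CycHom d D 1 T) (hS : CycHom d E 0 S) (hP : P = D + E + 1) :
    TZ.plug d D T S ∈ CC k A P :=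
  (mem_CC_iff d).2 ⟨hT.plug hS hP rfl, by rw [ev_plug]; rfl⟩

theorem plug_eq_zero (hT : CycHom d D 0 T) : plug d D T S = 0 :=
  ext_ev fun x => by rw [ev_plug', join_eq_zero d hT.homog, cyc_zero]; rfl

/-- As no path passes through `f`, the trees in which `T` is joined to both `S` and `f` are those of
`(T → f) → S`. -/
theorem ev_plug_plug_left (hT : CycHom d D m T) (hS : CycHom d E n S) (hf : CycHom d M 0 f)
    (hP : P = D + E + 1) (hQ : Q = D + M + 1) (x : List (Letter k A)) :
    ev (plug d P (plug d D T S) f) x = cyc d (chain d D P (ev T) (ev S) (ev f)) x +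
      sgn k (d + 1 + (E + d * n) * M) * ev (plug d Q (plug d D T f) S) x := by
  rw [ev_plug', ev_plug', join_cyc_join, cyc_add, Pi.add_apply,
    cyc_fan_symm d hT.cyclic hS.homog hf.homog hP hQ, ev_plug', ev_plug', join_cyc_join,
    chain_eq_zero d hf.homog, zero_add]
  simp

/-- Two inputs at the same vertex can be exchanged. -/
theorem plug_plug_symm (hT : CycHom d D m T) (hf : CycHom d E 0 f) (hg : CycHom d M 0 g)
    (hP : P = D + E + 1) (hQ : Q = D + M + 1) :
    plug d P (plug d D T f) g = sgn k (d + 1 + E * M) • plug d Q (plug d D T g) f :=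
  ext_ev fun x => by
    rw [ev_plug_plug_left hT hf hg hP hQ, chain_eq_zero d hf.homog, cyc_zero, ev_smul]
    simp

theorem ev_plug_plug_right (hT : CycHom d D m T) (hS : CycHom d E n S) (hf : CycHom d M 0 f)
    (hP : P = D + E + 1) (hQ : Q = D + M + 1) {t s : ZMod 2} (ht : t = D + d * m)
    (hs : s = E + d * n) (x : List (Letter k A)) :
    ev (plug d D T (plug d E S f)) x = cyc d (cofan d D E (ev T) (ev S) (ev f)) x +
      sgn k ((d + 1) * (t + 1)) * (ev (plug d P (plug d D T S) f) x -
        sgn k (d + 1 + s * M) * ev (plug d Q (plug d D T f) S) x) := by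
  rw [ev_plug_plug_left hT hS hf hP hQ, ← hs, add_sub_cancel_right,
    cyc_chain_eq d hT.homog hS.cyclic hP, ← ht, ← mul_assoc, ← sgn_add, CharTwo.add_self_eq_zero,
    sgn_zero, one_mul, ev_plug', ev_plug', join_join_cyc, cyc_add]
  rfl

/-- The commutator of two successive insertions into `f` is the insertion of the commutator,
up to the trees in which one vertex is joined both to `f` and to the other vertex. The trees in
which both vertices are joined to `f`, but not to each other, cancel. -/
theorem plug_plug_commutator (hT : CycHom d D m T) (hS : CycHom d E n S) (hf : CycHom d M 0 f)
    {Q' : ℤ} (hP : P = D + E + 1) (hQ : Q = D + M + 1) (hQ' : Q' = E + M + 1) {t s : ZMod 2}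
    (ht : t = D + d * m) (hs : s = E + d * n) :
    plug d D T (plug d E S f) - sgn k ((t + d + 1) * (s + d + 1)) • plug d E S (plug d D T f) =
      sgn k ((d + 1) * (t + 1)) • (plug d P (plug d D T S) f -
          sgn k (d + 1 + s * M) • plug d Q (plug d D T f) S) -
        sgn k ((t + d + 1) * (s + d + 1)) • sgn k ((d + 1) * (s + 1)) •
          (plug d P (plug d E S T) f - sgn k (d + 1 + t * M) • plug d Q' (plug d E S f) T) := by
  refine ext_ev fun x => ?_
  have hP' : P = E + D + 1 := by rw [hP]; ring
  simp only [ev_sub, ev_smul]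
  rw [ev_plug_plug_right hT hS hf hP hQ ht hs, ev_plug_plug_right hS hT hf hP' hQ' hs ht,
    cyc_cofan_symm d hT.homog hS.homog hf.cyclic, ← ht, ← hs]
  ring

end CycHom
/-! ### Consequences of the boundary condition -/

section Boundary

variable {k : Type u} [Field k] {A : ℤ → Type u} [∀ n, AddCommGroup (A n)]
  [∀ n, Module k (A n)] [∀ n, FiniteDimensional k (A n)] {d m₁ m₂ m₃ : ℤ}
  {v₁ v₂ v₃ f g h : Tensor k A}

theorem zmod_two_cases (z : ZMod 2) : z = 0 ∨ z = 1 := by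
  revert z
  decide

/-- The vertices of type `1`, `2`, `3`, of degrees `-2`, `-d`, `2 - 2d`, all have the parity of
`d`. -/
theorem vertexOne_par (d : ℤ) : (d : ZMod 2) = ((-2 : ℤ) : ZMod 2) + d * ((1 : ℕ) : ZMod 2) := by
  push_cast
  generalize (d : ZMod 2) = x
  revert x
  decide

theorem vertexTwo_par (d : ℤ) : (d : ZMod 2) = ((-d : ℤ) : ZMod 2) + d * ((2 : ℕ) : ZMod 2) := by
  push_cast
  generalize (d : ZMod 2) = x
  revert x
  decide

theorem vertexThree_par (d : ℤ) :
    (d : ZMod 2) = ((2 - 2 * d : ℤ) : ZMod 2) + d * ((3 : ℕ) : ZMod 2) := by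
  push_cast
  generalize (d : ZMod 2) = x
  revert x
  decide

/-- The commutator of `v₁` with itself is `2 v₁ v₁`, as the parity of `v₁` and that of an edge
add up to an odd number. -/
theorem type_one_square [CharZero k] (h₁ : CycHom d (-2) 1 v₁) (hf : CycHom d m₁ 0 f)
    (hb : plug d (-2) v₁ v₁ = 0) : plug d (-2) v₁ (plug d (-2) v₁ f) = 0 := by
  have e := plug_plug_commutator h₁ h₁ hf (P := -3) (Q := m₁ - 1) (Q' := m₁ - 1) (by ring)
    (by ring) (by ring) (t := d) (s := d) (vertexOne_par d)
    (vertexOne_par d)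
  have z : plug d (m₁ - 1) (plug d (-2) v₁ f) v₁ = 0 :=
    plug_eq_zero (h₁.plug hf (by ring) rfl)
  rw [hb, z] at e
  simp only [map_zero, LinearMap.zero_apply] at e
  -- The coefficients are signs which depend only on parities; once these are fixed, the claim is a
  -- linear consequence.
  generalize (d : ZMod 2) = x at e
  rcases zmod_two_cases x with rfl | rfl <;>
  · simp only [sgn_zero, sgn_one, zero_add, mul_zero, mul_one, CharTwo.add_self_eq_zero] at e
    linear_combination (norm := module) (1 / 2 : k) • e

/-- The boundary condition for type `2` with one input `f`. -/
theorem type_two_boundary (h₁ : CycHom d (-2) 1 v₁) (h₂ : CycHom d (-d) 2 v₂)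
    (hf : CycHom d m₁ 0 f) (hb : plug d (-2) v₁ v₂ + plug d (-d) v₂ v₁ = 0) :
    plug d (-2) v₁ (plug d (-d) v₂ f) + plug d (-d) v₂ (plug d (-2) v₁ f) +
      sgn k (d * m₁) • plug d (m₁ + 1 - d) (plug d (-d) v₂ f) v₁ = 0 := by
  have e := plug_plug_commutator h₁ h₂ hf (P := -1 - d) (Q := m₁ - 1) (Q' := m₁ + 1 - d) (by ring)
    (by ring) (by ring) (t := d) (s := d) (vertexOne_par d)
    (vertexTwo_par d)
  have z : plug d (m₁ - 1) (plug d (-2) v₁ f) v₂ = 0 :=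
    plug_eq_zero (h₁.plug hf (by ring) rfl)
  have b := congrArg (fun T => sgn k (d + 1) • plug d (-1 - d) T f) hb
  simp only [map_add, map_zero, LinearMap.add_apply, LinearMap.zero_apply, smul_zero] at b
  rw [z] at e
  generalize (d : ZMod 2) = x, (m₁ : ZMod 2) = y at e b ⊢
  rcases zmod_two_cases x with rfl | rfl <;> rcases zmod_two_cases y with rfl | rfl <;>
  · simp only [sgn_zero, sgn_one, zero_add, add_zero, mul_zero, mul_one,
      CharTwo.add_self_eq_zero] at e b ⊢
    linear_combination (norm := module) e + b

/-- The boundary condition for type `3` with one input `f`. -/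
theorem type_three_boundary [CharZero k] (h₁ : CycHom d (-2) 1 v₁) (h₂ : CycHom d (-d) 2 v₂)
    (h₃ : CycHom d (2 - 2 * d) 3 v₃) (hf : CycHom d m₁ 0 f)
    (hb : plug d (-2) v₁ v₃ + plug d (-d) v₂ v₂ + plug d (2 - 2 * d) v₃ v₁ = 0) :
    plug d (-2) v₁ (plug d (2 - 2 * d) v₃ f) + plug d (2 - 2 * d) v₃ (plug d (-2) v₁ f) +
      plug d (-d) v₂ (plug d (-d) v₂ f) +
      sgn k (d * m₁) • (plug d (m₁ + 3 - 2 * d) (plug d (2 - 2 * d) v₃ f) v₁ +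
        plug d (m₁ + 1 - d) (plug d (-d) v₂ f) v₂) = 0 := by
  have e₁ := plug_plug_commutator h₁ h₃ hf (P := 1 - 2 * d) (Q := m₁ - 1) (Q' := m₁ + 3 - 2 * d)
    (by ring) (by ring) (by ring) (t := d) (s := d) (vertexOne_par d)
    (vertexThree_par d)
  have e₂ := plug_plug_commutator h₂ h₂ hf (P := 1 - 2 * d) (Q := m₁ + 1 - d) (Q' := m₁ + 1 - d)
    (by ring) (by ring) (by ring) (t := d) (s := d) (vertexTwo_par d)
    (vertexTwo_par d)
  have z : plug d (m₁ - 1) (plug d (-2) v₁ f) v₃ = 0 :=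
    plug_eq_zero (h₁.plug hf (by ring) rfl)
  have b := congrArg (fun T => sgn k (d + 1) • plug d (1 - 2 * d) T f) hb
  simp only [map_add, map_zero, LinearMap.add_apply, LinearMap.zero_apply, smul_zero] at b
  rw [z] at e₁
  -- The commutator of `v₂` with itself counts every tree twice, whence the factor `1 / 2`.
  generalize (d : ZMod 2) = x, (m₁ : ZMod 2) = y at e₁ e₂ b ⊢
  rcases zmod_two_cases x with rfl | rfl <;> rcases zmod_two_cases y with rfl | rfl <;>
  · simp only [sgn_zero, sgn_one, zero_add, add_zero, mul_zero, mul_one,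
      CharTwo.add_self_eq_zero] at e₁ e₂ b ⊢
    linear_combination (norm := module) e₁ + (1 / 2 : k) • e₂ + b

/-- The boundary condition for type `2` with two inputs `f`, `g`. -/
theorem type_two_boundary₂ (h₁ : CycHom d (-2) 1 v₁) (h₂ : CycHom d (-d) 2 v₂)
    (hf : CycHom d m₁ 0 f) (hg : CycHom d m₂ 0 g)
    (hb : plug d (-2) v₁ v₂ + plug d (-d) v₂ v₁ = 0) :
    plug d (-2) v₁ (plug d (m₁ + 1 - d) (plug d (-d) v₂ f) g) -
      sgn k (m₁ + d) • plug d (m₁ + 1 - d) (plug d (-d) v₂ f) (plug d (-2) v₁ g) +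
      sgn k (d + 1) • plug d (m₁ - d) (plug d (-d) v₂ (plug d (-2) v₁ f)) g = 0 := by
  have hY : CycHom d (m₁ + 1 - d) 1 (plug d (-d) v₂ f) := h₂.plug hf (by ring) rfl
  have e := plug_plug_commutator h₁ hY hg (P := m₁ - d) (Q := m₂ - 1) (Q' := m₁ + m₂ + 2 - d)
    (by ring) (by ring) (by ring) (t := d) (s := m₁ + 1)
    (vertexOne_par d)
    (by push_cast; ring)
  have z₁ : plug d (m₂ - 1) (plug d (-2) v₁ g) (plug d (-d) v₂ f) = 0 :=
    plug_eq_zero (h₁.plug hg (by ring) rfl)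
  have z₂ : plug d (m₁ + m₂ + 2 - d) (plug d (m₁ + 1 - d) (plug d (-d) v₂ f) g) v₁ = 0 :=
    plug_eq_zero (hY.plug hg (by ring) rfl)
  have b := congrArg (fun T => sgn k (d + 1) • plug d (m₁ - d) T g) (type_two_boundary h₁ h₂ hf hb)
  simp only [map_add, map_smul, map_zero, LinearMap.add_apply, LinearMap.smul_apply,
    LinearMap.zero_apply, smul_zero] at b
  rw [z₁, z₂] at e
  generalize (d : ZMod 2) = x, (m₁ : ZMod 2) = y, (m₂ : ZMod 2) = z at e b ⊢
  rcases zmod_two_cases x with rfl | rfl <;> rcases zmod_two_cases y with rfl | rfl <;>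
    rcases zmod_two_cases z with rfl | rfl <;>
  · simp only [sgn_zero, sgn_one, zero_add, add_zero, mul_zero, mul_one,
      CharTwo.add_self_eq_zero] at e b ⊢
    linear_combination (norm := module) e + b

/-- The boundary condition for type `3` with two inputs `f`, `g`. -/
theorem type_three_boundary₂ [CharZero k] (h₁ : CycHom d (-2) 1 v₁) (h₂ : CycHom d (-d) 2 v₂)
    (h₃ : CycHom d (2 - 2 * d) 3 v₃) (hf : CycHom d m₁ 0 f) (hg : CycHom d m₂ 0 g)
    (hb : plug d (-2) v₁ v₃ + plug d (-d) v₂ v₂ + plug d (2 - 2 * d) v₃ v₁ = 0) :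
    plug d (-2) v₁ (plug d (m₁ + 3 - 2 * d) (plug d (2 - 2 * d) v₃ f) g) +
      plug d (-d) v₂ (plug d (m₁ + 1 - d) (plug d (-d) v₂ f) g) -
      sgn k (m₁ + d) • (plug d (m₁ + 3 - 2 * d) (plug d (2 - 2 * d) v₃ f) (plug d (-2) v₁ g) +
        plug d (m₁ + 1 - d) (plug d (-d) v₂ f) (plug d (-d) v₂ g)) +
      sgn k (d + 1) • plug d (m₁ + 2 - 2 * d) (plug d (2 - 2 * d) v₃ (plug d (-2) v₁ f)) g +
      sgn k (d * m₁ + d * m₂) • plug d (m₁ + m₂ + 4 - 2 * d)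
        (plug d (m₁ + 3 - 2 * d) (plug d (2 - 2 * d) v₃ f) g) v₁ +
      sgn k ((m₁ + 1) * m₂) • plug d (m₂ + 1 - d) (plug d (-d) v₂ g) (plug d (-d) v₂ f) = 0 := by
  have hX : CycHom d (m₁ + 3 - 2 * d) 2 (plug d (2 - 2 * d) v₃ f) := h₃.plug hf (by ring) rfl
  have hY : CycHom d (m₁ + 1 - d) 1 (plug d (-d) v₂ f) := h₂.plug hf (by ring) rfl
  have e₁ := plug_plug_commutator h₁ hX hg (P := m₁ + 2 - 2 * d) (Q := m₂ - 1)
    (Q' := m₁ + m₂ + 4 - 2 * d) (by ring) (by ring) (by ring) (t := d) (s := m₁ + 1)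
    (vertexOne_par d)
    (by push_cast; generalize (d : ZMod 2) = x, (m₁ : ZMod 2) = y; revert x y; decide)
  have e₂ := plug_plug_commutator h₂ hY hg (P := m₁ + 2 - 2 * d) (Q := m₂ + 1 - d)
    (Q' := m₁ + m₂ + 2 - d) (by ring) (by ring) (by ring) (t := d) (s := m₁ + 1)
    (vertexTwo_par d)
    (by push_cast; ring)
  have z₁ : plug d (m₂ - 1) (plug d (-2) v₁ g) (plug d (2 - 2 * d) v₃ f) = 0 :=
    plug_eq_zero (h₁.plug hg (by ring) rfl)
  have z₂ : plug d (m₁ + m₂ + 2 - d) (plug d (m₁ + 1 - d) (plug d (-d) v₂ f) g) v₂ = 0 :=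
    plug_eq_zero (hY.plug hg (by ring) rfl)
  have b := congrArg (fun T => sgn k (d + 1) • plug d (m₁ + 2 - 2 * d) T g)
    (type_three_boundary h₁ h₂ h₃ hf hb)
  simp only [map_add, map_smul, map_zero, LinearMap.add_apply, LinearMap.smul_apply,
    LinearMap.zero_apply, smul_zero] at b
  rw [z₁] at e₁
  rw [z₂] at e₂
  generalize (d : ZMod 2) = x, (m₁ : ZMod 2) = y, (m₂ : ZMod 2) = z at e₁ e₂ b ⊢
  rcases zmod_two_cases x with rfl | rfl <;> rcases zmod_two_cases y with rfl | rfl <;>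
    rcases zmod_two_cases z with rfl | rfl <;>
  · simp only [sgn_zero, sgn_one, zero_add, add_zero, mul_zero, mul_one,
      CharTwo.add_self_eq_zero] at e₁ e₂ b ⊢
    linear_combination (norm := module) e₁ + e₂ + b

set_option maxHeartbeats 1000000 in
/-- The boundary condition for type `3` with three inputs `f`, `g`, `h`. -/
theorem type_three_boundary₃ [CharZero k] (h₁ : CycHom d (-2) 1 v₁) (h₂ : CycHom d (-d) 2 v₂)
    (h₃ : CycHom d (2 - 2 * d) 3 v₃) (hf : CycHom d m₁ 0 f) (hg : CycHom d m₂ 0 g)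
    (hh : CycHom d m₃ 0 h)
    (hb : plug d (-2) v₁ v₃ + plug d (-d) v₂ v₂ + plug d (2 - 2 * d) v₃ v₁ = 0) :
    sgn k (d + 1) • plug d (-2) v₁ (plug d (m₁ + m₂ + 4 - 2 * d)
        (plug d (m₁ + 3 - 2 * d) (plug d (2 - 2 * d) v₃ f) g) h) -
      sgn k (d + m₁ + m₂) • plug d (m₁ + m₂ + 4 - 2 * d)
        (plug d (m₁ + 3 - 2 * d) (plug d (2 - 2 * d) v₃ f) g) (plug d (-2) v₁ h) -
      sgn k (m₁ + d) • plug d (m₁ + m₂ + 3 - 2 * d) (plug d (m₁ + 3 - 2 * d)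
        (plug d (2 - 2 * d) v₃ f) (plug d (-2) v₁ g)) h +
      sgn k (d + 1) • plug d (m₁ + m₂ + 3 - 2 * d)
        (plug d (m₁ + 2 - 2 * d) (plug d (2 - 2 * d) v₃ (plug d (-2) v₁ f)) g) h +
      plug d (m₁ + m₂ + 3 - 2 * d)
        (plug d (-d) v₂ (plug d (m₁ + 1 - d) (plug d (-d) v₂ f) g)) h +
      sgn k ((m₁ + d) * m₂) • plug d (m₂ + 1 - d) (plug d (-d) v₂ g)
        (plug d (m₁ + 1 - d) (plug d (-d) v₂ f) h) +
      sgn k (m₁ * d + d + 1) • plug d (m₁ + 1 - d) (plug d (-d) v₂ f)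
        (plug d (m₂ + 1 - d) (plug d (-d) v₂ g) h) = 0 := by
  have hX : CycHom d (m₁ + 3 - 2 * d) 2 (plug d (2 - 2 * d) v₃ f) := h₃.plug hf (by ring) rfl
  have hZ : CycHom d (m₁ + m₂ + 4 - 2 * d) 1
      (plug d (m₁ + 3 - 2 * d) (plug d (2 - 2 * d) v₃ f) g) := hX.plug hg (by ring) rfl
  have hY : CycHom d (m₁ + 1 - d) 1 (plug d (-d) v₂ f) := h₂.plug hf (by ring) rfl
  have hY' : CycHom d (m₂ + 1 - d) 1 (plug d (-d) v₂ g) := h₂.plug hg (by ring) rfl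
  have e₁ := plug_plug_commutator h₁ hZ hh (P := m₁ + m₂ + 3 - 2 * d) (Q := m₃ - 1)
    (Q' := m₁ + m₂ + m₃ + 5 - 2 * d) (by ring) (by ring) (by ring) (t := d) (s := m₁ + m₂ + d)
    (vertexOne_par d)
    (by push_cast; generalize (d : ZMod 2) = x, (m₁ : ZMod 2) = y, (m₂ : ZMod 2) = z
        revert x y z; decide)
  have e₂ := plug_plug_commutator hY' hY hh (P := m₁ + m₂ + 3 - 2 * d) (Q := m₂ + m₃ + 2 - d)
    (Q' := m₁ + m₃ + 2 - d) (by ring) (by ring) (by ring) (t := m₂ + 1) (s := m₁ + 1)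
    (by push_cast; ring)
    (by push_cast; ring)
  have z₁ : plug d (m₃ - 1) (plug d (-2) v₁ h)
      (plug d (m₁ + 3 - 2 * d) (plug d (2 - 2 * d) v₃ f) g) = 0 :=
    plug_eq_zero (h₁.plug hh (by ring) rfl)
  have z₂ : plug d (m₁ + m₂ + m₃ + 5 - 2 * d) (plug d (m₁ + m₂ + 4 - 2 * d)
      (plug d (m₁ + 3 - 2 * d) (plug d (2 - 2 * d) v₃ f) g) h) v₁ = 0 :=
    plug_eq_zero (hZ.plug hh (by ring) rfl)
  have z₃ : plug d (m₂ + m₃ + 2 - d) (plug d (m₂ + 1 - d) (plug d (-d) v₂ g) h)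
      (plug d (-d) v₂ f) = 0 := plug_eq_zero (hY'.plug hh (by ring) rfl)
  have z₄ : plug d (m₁ + m₃ + 2 - d) (plug d (m₁ + 1 - d) (plug d (-d) v₂ f) h)
      (plug d (-d) v₂ g) = 0 := plug_eq_zero (hY.plug hh (by ring) rfl)
  have b := congrArg (fun T => plug d (m₁ + m₂ + 3 - 2 * d) T h)
    (type_three_boundary₂ h₁ h₂ h₃ hf hg hb)
  simp only [map_add, map_sub, map_smul, map_zero, LinearMap.add_apply, LinearMap.sub_apply,
    LinearMap.smul_apply, LinearMap.zero_apply] at b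
  rw [z₁, z₂] at e₁
  rw [z₃, z₄] at e₂
  replace e₁ := congrArg (fun T => sgn k (d + 1) • T) e₁
  replace e₂ := congrArg (fun T => sgn k ((m₁ + d) * m₂) • T) e₂
  generalize (d : ZMod 2) = x, (m₁ : ZMod 2) = y, (m₂ : ZMod 2) = z, (m₃ : ZMod 2) = w
    at e₁ e₂ b ⊢
  rcases zmod_two_cases x with rfl | rfl <;> rcases zmod_two_cases y with rfl | rfl <;>
    rcases zmod_two_cases z with rfl | rfl <;> rcases zmod_two_cases w with rfl | rfl <;>
  · simp only [sgn_zero, sgn_one, zero_add, add_zero, mul_zero, mul_one,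
      CharTwo.add_self_eq_zero] at e₁ e₂ b ⊢
    linear_combination (norm := module) e₁ + e₂ + b

end Boundary
namespace VAlgebra

/-! ### The differential, the bracket and the homotopy -/

section Operations

variable {k : Type u} [Field k] {A : ℤ → Type u} [∀ n, AddCommGroup (A n)] [∀ n, Module k (A n)]
  {d : ℤ} {m₁ m₂ m₃ : ℤ} {f g h : Tensor k A}

theorem vdeg_one (d : ℤ) : vdeg d 1 = -2 := by rw [vdeg]; push_cast; ring
theorem vdeg_two (d : ℤ) : vdeg d 2 = -d := by rw [vdeg]; push_cast; ring
theorem vdeg_three (d : ℤ) : vdeg d 3 = 2 - 2 * d := by rw [vdeg]; push_cast; ring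

section

variable {K : ℕ∞} (V : VAlgebra K d k A)

theorem cycHom_one : CycHom d (-2) 1 (ofType 1 V.v) := vdeg_one d ▸ V.cycHom_ofType 1
theorem cycHom_two : CycHom d (-d) 2 (ofType 2 V.v) := vdeg_two d ▸ V.cycHom_ofType 2
theorem cycHom_three : CycHom d (2 - 2 * d) 3 (ofType 3 V.v) := vdeg_three d ▸ V.cycHom_ofType 3

theorem boundary_one (hK : 1 ≤ K) : plug d (-2) (ofType 1 V.v) (ofType 1 V.v) = 0 := by
  have := V.boundary 1 le_rfl (by exact_mod_cast hK)
  simpa [vdeg_one] using this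

theorem boundary_two (hK : 2 ≤ K) : plug d (-2) (ofType 1 V.v) (ofType 2 V.v) +
    plug d (-d) (ofType 2 V.v) (ofType 1 V.v) = 0 := by
  have := V.boundary 2 one_le_two (by exact_mod_cast hK)
  simpa [Finset.sum_range_succ, vdeg_one, vdeg_two] using this

theorem boundary_three (hK : 3 ≤ K) : plug d (-2) (ofType 1 V.v) (ofType 3 V.v) +
    plug d (-d) (ofType 2 V.v) (ofType 2 V.v) +
    plug d (2 - 2 * d) (ofType 3 V.v) (ofType 1 V.v) = 0 := by
  have := V.boundary 3 (by norm_num) (by exact_mod_cast hK)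
  simpa [Finset.sum_range_succ, vdeg_one, vdeg_two, vdeg_three] using this

theorem delta_eq (m : ℤ) (f : Tensor k A) :
    V.delta m f = sgn k m • plug d (-2) (ofType 1 V.v) f := by
  rw [delta, vdeg_one, ← negOnePow_smul_eq_sgn]
  rfl

theorem bracket_eq {m P : ℤ} (hP : P = m + 1 - d) (f g : Tensor k A) :
    V.bracket m f g = sgn k (d + 1 + d * m) • plug d P (plug d (-d) (ofType 2 V.v) f) g := by
  have h : ((d + 1 + d * m : ℤ) : ZMod 2) = d + 1 + d * m := by push_cast; rfl
  have hP' : P = vdeg d 2 + m + 1 := by rw [hP, vdeg_two]; ring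
  rw [hP', ← h, ← negOnePow_smul_eq_sgn, ← vdeg_two]
  rfl

theorem homotopy_eq {P Q : ℤ} (hP : P = m₁ + m₂ + 4 - 2 * d) (hQ : Q = m₁ + 3 - 2 * d)
    (f g h : Tensor k A) :
    V.homotopy m₁ m₂ f g h = plug d P (plug d Q (plug d (2 - 2 * d) (ofType 3 V.v) f) g) h := by
  have hP' : P = vdeg d 3 + m₁ + 1 + m₂ + 1 := by rw [hP, vdeg_three]; ring
  have hQ' : Q = vdeg d 3 + m₁ + 1 := by rw [hQ, vdeg_three]; ring
  rw [hP', hQ', ← vdeg_three]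
  rfl

variable [∀ n, FiniteDimensional k (A n)]

theorem delta_mem (hf : f ∈ CC k A m₁) : V.delta m₁ f ∈ CC k A (m₁ - 1) := by
  rw [delta_eq]
  exact Submodule.smul_mem _ _ (plug_mem_CC V.cycHom_one ((mem_CC_iff d).1 hf).1 (by ring))

theorem delta_delta [CharZero k] (hK : 1 ≤ K) (hf : f ∈ CC k A m₁) :
    V.delta (m₁ - 1) (V.delta m₁ f) = 0 := by
  rw [delta_eq, delta_eq, map_smul,
    type_one_square V.cycHom_one ((mem_CC_iff d).1 hf).1 (V.boundary_one hK), smul_zero, smul_zero]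

theorem bracket_mem (hf : f ∈ CC k A m₁) (hg : g ∈ CC k A m₂) :
    V.bracket m₁ f g ∈ CC k A (m₁ + m₂ + 2 - d) := by
  rw [V.bracket_eq rfl]
  exact Submodule.smul_mem _ _ (plug_mem_CC
    (V.cycHom_two.plug ((mem_CC_iff d).1 hf).1 (by ring) rfl) ((mem_CC_iff d).1 hg).1 (by ring))

theorem homotopy_mem (hf : f ∈ CC k A m₁) (hg : g ∈ CC k A m₂) (hh : h ∈ CC k A m₃) :
    V.homotopy m₁ m₂ f g h ∈ CC k A (m₁ + m₂ + m₃ + 5 - 2 * d) := by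
  rw [V.homotopy_eq rfl rfl]
  exact plug_mem_CC ((V.cycHom_three.plug ((mem_CC_iff d).1 hf).1 (by ring) rfl).plug
    ((mem_CC_iff d).1 hg).1 (by ring) rfl) ((mem_CC_iff d).1 hh).1 (by ring)

theorem bracket_skew (hf : f ∈ CC k A m₁) (hg : g ∈ CC k A m₂) :
    V.bracket m₁ f g = -(((m₁ + d) * (m₂ + d)).negOnePow • V.bracket m₂ g f) := by
  rw [V.bracket_eq rfl, V.bracket_eq rfl, plug_plug_symm V.cycHom_two ((mem_CC_iff d).1 hf).1
    ((mem_CC_iff d).1 hg).1 (by ring) (Q := m₂ + 1 - d) (by ring),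
    negOnePow_smul_eq_sgn (k := k)]
  push_cast
  generalize (d : ZMod 2) = x, (m₁ : ZMod 2) = y, (m₂ : ZMod 2) = z
  rcases zmod_two_cases x with rfl | rfl <;> rcases zmod_two_cases y with rfl | rfl <;>
    rcases zmod_two_cases z with rfl | rfl <;>
  · simp only [sgn_zero, sgn_one, zero_add, add_zero, mul_zero, mul_one,
      CharTwo.add_self_eq_zero]
    module

theorem delta_bracket (hK : 2 ≤ K) (hf : f ∈ CC k A m₁) (hg : g ∈ CC k A m₂) :
    V.delta (m₁ + m₂ + 2 - d) (V.bracket m₁ f g) =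
      (m₂ + d).negOnePow • V.bracket (m₁ - 1) (V.delta m₁ f) g +
        V.bracket m₁ f (V.delta m₂ g) := by
  have b := congrArg (fun T => sgn k (m₁ + m₂ + 1 + d * m₁) • T) (type_two_boundary₂ V.cycHom_one
    V.cycHom_two ((mem_CC_iff d).1 hf).1 ((mem_CC_iff d).1 hg).1 (V.boundary_two hK))
  simp only [delta_eq, V.bracket_eq (P := m₁ + 1 - d) rfl, map_smul, LinearMap.smul_apply,
    V.bracket_eq (m := m₁ - 1) (P := m₁ - d) (by ring), negOnePow_smul_eq_sgn (k := k)]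
  push_cast
  generalize (d : ZMod 2) = x, (m₁ : ZMod 2) = y, (m₂ : ZMod 2) = z at b ⊢
  have h2 : (2 : ZMod 2) = 0 := rfl
  rcases zmod_two_cases x with rfl | rfl <;> rcases zmod_two_cases y with rfl | rfl <;>
    rcases zmod_two_cases z with rfl | rfl <;>
  · simp only [sgn_zero, sgn_one, zero_add, add_zero, mul_zero, mul_one, h2, CharTwo.sub_eq_add,
      CharTwo.add_self_eq_zero] at b ⊢
    linear_combination (norm := module) b

set_option maxHeartbeats 1000000 in
theorem jacobi_homotopy [CharZero k] (hK : 3 ≤ K) (hf : f ∈ CC k A m₁) (hg : g ∈ CC k A m₂)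
    (hh : h ∈ CC k A m₃) :
    V.bracket m₁ f (V.bracket m₂ g h) - V.bracket (m₁ + m₂ + 2 - d) (V.bracket m₁ f g) h -
        ((m₁ + d) * (m₂ + d)).negOnePow • V.bracket m₂ g (V.bracket m₁ f h) =
      (d * m₂ + m₁ + m₂ + m₃).negOnePow •
        (V.delta (m₁ + m₂ + m₃ + 5 - 2 * d) (V.homotopy m₁ m₂ f g h) -
          (m₂ + m₃).negOnePow • V.homotopy (m₁ - 1) m₂ (V.delta m₁ f) g h -
          m₃.negOnePow • V.homotopy m₁ (m₂ - 1) f (V.delta m₂ g) h -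
          V.homotopy m₁ m₂ f g (V.delta m₃ h)) := by
  have b := congrArg (fun T => sgn k (d * m₂ + d + 1) • T) (type_three_boundary₃ V.cycHom_one
    V.cycHom_two V.cycHom_three ((mem_CC_iff d).1 hf).1 ((mem_CC_iff d).1 hg).1
    ((mem_CC_iff d).1 hh).1 (V.boundary_three hK))
  simp only [delta_eq, V.bracket_eq (m := m₁) rfl, V.bracket_eq (m := m₂) rfl,
    V.bracket_eq (m := m₁ + m₂ + 2 - d) (P := m₁ + m₂ + 3 - 2 * d) (by ring),
    V.homotopy_eq (m₁ := m₁) (m₂ := m₂) rfl rfl,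
    V.homotopy_eq (m₁ := m₁ - 1) (m₂ := m₂) (P := m₁ + m₂ + 3 - 2 * d) (Q := m₁ + 2 - 2 * d)
      (by ring) (by ring),
    V.homotopy_eq (m₁ := m₁) (m₂ := m₂ - 1) (P := m₁ + m₂ + 3 - 2 * d) (Q := m₁ + 3 - 2 * d)
      (by ring) (by ring), map_smul, LinearMap.smul_apply, negOnePow_smul_eq_sgn (k := k)]
  push_cast
  generalize (d : ZMod 2) = x, (m₁ : ZMod 2) = y, (m₂ : ZMod 2) = z, (m₃ : ZMod 2) = w at b ⊢
  have h2 : (2 : ZMod 2) = 0 := rfl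
  have h5 : (5 : ZMod 2) = 1 := rfl
  rcases zmod_two_cases x with rfl | rfl <;> rcases zmod_two_cases y with rfl | rfl <;>
    rcases zmod_two_cases z with rfl | rfl <;> rcases zmod_two_cases w with rfl | rfl <;>
  · simp only [sgn_zero, sgn_one, zero_add, add_zero, mul_zero, mul_one, h2, h5,
      CharTwo.sub_eq_add, CharTwo.add_self_eq_zero] at b ⊢
    linear_combination (norm := module) b

end

end Operations

/-! ### The bracket on cohomology -/

section Cohomology

variable {k : Type u} [Field k] {A : ℤ → Type u} [∀ n, AddCommGroup (A n)]
  [∀ n, Module k (A n)] {d : ℤ} {K : ℕ∞} (V : VAlgebra K d k A)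
  {m₁ m₂ m₃ n : ℤ} {f g h : Tensor k A}

theorem mem_Z : f ∈ V.Z m₁ ↔ f ∈ CC k A m₁ ∧ V.delta m₁ f = 0 := Iff.rfl

theorem lof_cls_eq {i j : ℤ} (hij : i = j) (hf : f ∈ V.Z (i + d - 2)) :
    DirectSum.lof k ℤ (fun i => V.HC (i + d - 2)) i (V.cls f hf) =
      DirectSum.lof k ℤ (fun i => V.HC (i + d - 2)) j (V.cls f (hij ▸ hf)) := by
  subst hij
  rfl

theorem exists_cls (x : V.HC m₁) : ∃ (f : Tensor k A) (hf : f ∈ V.Z m₁), x = V.cls f hf := by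
  obtain ⟨⟨f, hf⟩, rfl⟩ := Submodule.Quotient.mk_surjective _ x
  exact ⟨f, hf, rfl⟩

theorem smul_cls (c : k) (hf : f ∈ V.Z m₁) :
    c • V.cls f hf = V.cls (c • f) (Submodule.smul_mem _ c hf) := rfl

theorem neg_cls (hf : f ∈ V.Z m₁) : -V.cls f hf = V.cls (-f) (Submodule.neg_mem _ hf) := rfl

theorem add_cls (hf : f ∈ V.Z m₁) (hg : g ∈ V.Z m₁) :
    V.cls f hf + V.cls g hg = V.cls (f + g) (Submodule.add_mem _ hf hg) := rfl

theorem cls_eq_cls_iff (hf : f ∈ V.Z m₁) (hg : g ∈ V.Z m₁) :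
    V.cls f hf = V.cls g hg ↔ f - g ∈ V.B m₁ :=
  Submodule.Quotient.eq _

theorem homotopy_zero_left : V.homotopy m₁ m₂ 0 g h = 0 := by
  rw [V.homotopy_eq rfl rfl]
  simp only [map_zero, LinearMap.zero_apply]

theorem homotopy_zero_middle : V.homotopy m₁ m₂ f 0 h = 0 := by
  rw [V.homotopy_eq rfl rfl]
  simp only [map_zero, LinearMap.zero_apply]

theorem homotopy_zero_right : V.homotopy m₁ m₂ f g 0 = 0 := by
  rw [V.homotopy_eq rfl rfl, map_zero]

variable [∀ n, FiniteDimensional k (A n)]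

theorem bracket_mem_Z (hK : 2 ≤ K) (hn : n = m₁ + m₂ + 2 - d) (hf : f ∈ V.Z m₁)
    (hg : g ∈ V.Z m₂) : V.bracket m₁ f g ∈ V.Z n := by
  subst hn
  rw [mem_Z] at *
  refine ⟨V.bracket_mem hf.1 hg.1, ?_⟩
  rw [V.delta_bracket hK hf.1 hg.1, hf.2, hg.2, map_zero, map_zero, LinearMap.zero_apply, smul_zero,
    add_zero]

/-- If `f = δ f'` and `δ g = 0`, then `[f, g] = ± δ [f', g]`. -/
theorem bracket_mem_B_left (hK : 2 ≤ K) (hn : n = m₁ + m₂ + 2 - d) (hf : f ∈ V.B m₁)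
    (hg : g ∈ V.Z m₂) : V.bracket m₁ f g ∈ V.B n := by
  obtain ⟨f', hf', rfl⟩ := hf
  rw [mem_Z] at hg
  have e := V.delta_bracket hK hf' hg.1
  rw [hg.2, map_zero, add_zero, add_sub_cancel_right,
    show m₁ + 1 + m₂ + 2 - d = n + 1 by rw [hn]; ring] at e
  refine ⟨(m₂ + d).negOnePow • V.bracket (m₁ + 1) f' g, ?_, ?_⟩
  · rw [negOnePow_smul_eq_sgn (k := k)]
    refine Submodule.smul_mem _ _ ?_
    have := V.bracket_mem hf' hg.1
    rwa [show m₁ + 1 + m₂ + 2 - d = n + 1 by rw [hn]; ring] at this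
  · have h : ∀ x : Tensor k A, V.delta (n + 1) ((m₂ + d).negOnePow • x) =
        (m₂ + d).negOnePow • V.delta (n + 1) x := fun x => by
      rw [negOnePow_smul_eq_sgn (k := k), negOnePow_smul_eq_sgn (k := k), map_smul]
    rw [h, e, smul_smul, ← Int.negOnePow_add, Int.negOnePow_even _ (Even.add_self _), one_smul]

variable [CharZero k]

theorem B_le_Z (hK : 1 ≤ K) : V.B m₁ ≤ V.Z m₁ := by
  rintro _ ⟨f, hf, rfl⟩
  rw [mem_Z]
  have h1 := V.delta_mem hf
  have h2 := V.delta_delta hK hf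
  rw [add_sub_cancel_right] at h1 h2
  exact ⟨h1, h2⟩

theorem bracket_mem_B_right (hK : 2 ≤ K) (hn : n = m₁ + m₂ + 2 - d) (hf : f ∈ V.Z m₁)
    (hg : g ∈ V.B m₂) : V.bracket m₁ f g ∈ V.B n := by
  rw [V.bracket_skew hf.1 (V.B_le_Z (one_le_two.trans hK) hg).1, negOnePow_smul_eq_sgn (k := k)]
  exact Submodule.neg_mem _ (Submodule.smul_mem _ _
    (V.bracket_mem_B_left hK (by rw [hn]; ring) hg hf))

/-- The bracket of cocycles, with values in cohomology. -/
noncomputable def bracketZ (hK : 2 ≤ K) (hn : n = m₁ + m₂ + 2 - d) :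
    V.Z m₁ →ₗ[k] V.Z m₂ →ₗ[k] V.HC n :=
  (LinearMap.mk₂ k (fun (f : V.Z m₁) (g : V.Z m₂) =>
      (⟨V.bracket m₁ f g, V.bracket_mem_Z hK hn f.2 g.2⟩ : V.Z n))
    (fun f f' g => Subtype.ext (by simp))
    (fun c f g => Subtype.ext (by simp))
    (fun f g g' => Subtype.ext (by simp))
    (fun c f g => Subtype.ext (by simp))).compr₂ (Submodule.mkQ _)

/-- The bracket on cohomology. -/
noncomputable def bracketHC (hK : 2 ≤ K) (hn : n = m₁ + m₂ + 2 - d) :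
    V.HC m₁ →ₗ[k] V.HC m₂ →ₗ[k] V.HC n :=
  (((V.B m₂).submoduleOf (V.Z m₂)).liftQ
    (((V.B m₁).submoduleOf (V.Z m₁)).liftQ (V.bracketZ hK hn) fun f hf =>
      LinearMap.ext fun g => (Submodule.Quotient.mk_eq_zero _).2
        (V.bracket_mem_B_left hK hn hf g.2)).flip
    fun g hg => LinearMap.ext fun x => by
      obtain ⟨f, rfl⟩ := Submodule.Quotient.mk_surjective _ x
      exact (Submodule.Quotient.mk_eq_zero _).2 (V.bracket_mem_B_right hK hn f.2 hg)).flip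

theorem bracketHC_cls (hK : 2 ≤ K) (hn : n = m₁ + m₂ + 2 - d) (hf : f ∈ V.Z m₁)
    (hg : g ∈ V.Z m₂) : V.bracketHC hK hn (V.cls f hf) (V.cls g hg) =
      V.cls (V.bracket m₁ f g) (V.bracket_mem_Z hK hn hf hg) := rfl

theorem isGradedLie_bracketHC (hK : 3 ≤ K) :
    IsGradedLie (k := k) (L := fun i => V.HC (i + d - 2)) fun i j =>
      V.bracketHC (le_trans (by norm_num) hK)
        (show i + j + d - 2 = (i + d - 2) + (j + d - 2) + 2 - d by ring) := by
  have hK2 : 2 ≤ K := le_trans (by norm_num) hK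
  have hpar : ∀ i j : ℤ, (((i + d - 2 + d) * (j + d - 2 + d) : ℤ)).negOnePow = (i * j).negOnePow :=
    fun i j => by
      rw [Int.negOnePow_eq_iff]
      exact ⟨i * (d - 1) + (d - 1) * j + 2 * (d - 1) * (d - 1), by ring⟩
  refine ⟨fun i j x y => ?_, fun i j l x y z => ?_⟩
  · obtain ⟨f, hf, rfl⟩ := V.exists_cls x
    obtain ⟨g, hg, rfl⟩ := V.exists_cls y
    rw [bracketHC_cls, bracketHC_cls, V.lof_cls_eq (add_comm j i),
      negOnePow_smul_eq_sgn (k := k), ← map_smul, ← map_neg, smul_cls, neg_cls]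
    congr 1
    rw [cls_eq_cls_iff, V.bracket_skew hf.1 hg.1, hpar, negOnePow_smul_eq_sgn (k := k), sub_self]
    exact Submodule.zero_mem _
  · obtain ⟨f, hf, rfl⟩ := V.exists_cls x
    obtain ⟨g, hg, rfl⟩ := V.exists_cls y
    obtain ⟨h, hh, rfl⟩ := V.exists_cls z
    rw [bracketHC_cls, bracketHC_cls, bracketHC_cls, bracketHC_cls, bracketHC_cls, bracketHC_cls,
      V.lof_cls_eq (show j + (i + l) = i + j + l by ring),
      V.lof_cls_eq (show i + (j + l) = i + j + l by ring),
      negOnePow_smul_eq_sgn (k := k), ← map_smul, ← map_add, smul_cls, add_cls]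
    congr 1
    rw [cls_eq_cls_iff]
    have e := V.jacobi_homotopy hK hf.1 hg.1 hh.1
    rw [(V.mem_Z.1 hf).2, (V.mem_Z.1 hg).2, (V.mem_Z.1 hh).2, hpar] at e
    have hH := V.homotopy_mem hf.1 hg.1 hh.1
    simp only [homotopy_zero_left, homotopy_zero_middle, homotopy_zero_right, smul_zero, sub_zero,
      negOnePow_smul_eq_sgn (k := k)] at e
    rw [show i + d - 2 + (j + d - 2) + 2 - d = i + j + d - 2 by ring] at e
    rw [show i + d - 2 + (j + d - 2) + (l + d - 2) + 5 - 2 * d = i + j + l + d - 2 + 1 by ring]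
      at e hH
    rw [← sub_sub, e]
    exact Submodule.smul_mem _ _ (Submodule.mem_map_of_mem hH)

end Cohomology

end VAlgebra

end TZ

theorem mainTheorem4 {k : Type u} [Field k] [CharZero k] {A : ℤ → Type u}
    [∀ n, AddCommGroup (A n)] [∀ n, Module k (A n)] [∀ n, FiniteDimensional k (A n)]
    (d : ℤ) (V : TZ.VAlgebra 3 d k A) :
    -- `(CC, δ)` is a complex
    (∀ (m : ℤ), ∀ f ∈ TZ.CC k A m,
      V.delta m f ∈ TZ.CC k A (m - 1) ∧ V.delta (m - 1) (V.delta m f) = 0) ∧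
    -- the bracket is an operation on `CC` of degree `2 - d`, skew-symmetric and closed
    (∀ (m₁ m₂ : ℤ), ∀ f ∈ TZ.CC k A m₁, ∀ g ∈ TZ.CC k A m₂,
      V.bracket m₁ f g ∈ TZ.CC k A (m₁ + m₂ + 2 - d) ∧
      V.bracket m₁ f g = -(((m₁ + d) * (m₂ + d)).negOnePow • V.bracket m₂ g f) ∧
      V.delta (m₁ + m₂ + 2 - d) (V.bracket m₁ f g) =
        (m₂ + d).negOnePow • V.bracket (m₁ - 1) (V.delta m₁ f) g +
          V.bracket m₁ f (V.delta m₂ g)) ∧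
    -- the Jacobi identity holds up to the homotopy given by the type `3` vertices
    (∀ (m₁ m₂ m₃ : ℤ), ∀ f ∈ TZ.CC k A m₁, ∀ g ∈ TZ.CC k A m₂, ∀ h ∈ TZ.CC k A m₃,
      V.homotopy m₁ m₂ f g h ∈ TZ.CC k A (m₁ + m₂ + m₃ + 5 - 2 * d) ∧
      V.bracket m₁ f (V.bracket m₂ g h) -
          V.bracket (m₁ + m₂ + 2 - d) (V.bracket m₁ f g) h -
          ((m₁ + d) * (m₂ + d)).negOnePow • V.bracket m₂ g (V.bracket m₁ f h) =
        (d * m₂ + m₁ + m₂ + m₃).negOnePow •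
          (V.delta (m₁ + m₂ + m₃ + 5 - 2 * d) (V.homotopy m₁ m₂ f g h) -
            (m₂ + m₃).negOnePow • V.homotopy (m₁ - 1) m₂ (V.delta m₁ f) g h -
            m₃.negOnePow • V.homotopy m₁ (m₂ - 1) f (V.delta m₂ g) h -
            V.homotopy m₁ m₂ f g (V.delta m₃ h))) ∧
    -- the bracket induces a graded Lie algebra structure on `HC`, shifted by `2 - d`
    ∃ b : ∀ i j : ℤ, V.HC (i + d - 2) →ₗ[k] V.HC (j + d - 2) →ₗ[k] V.HC (i + j + d - 2),
      (∀ (i j : ℤ) (f g : TZ.Tensor k A) (hf : f ∈ V.Z (i + d - 2)) (hg : g ∈ V.Z (j + d - 2)),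
        ∃ hfg : V.bracket (i + d - 2) f g ∈ V.Z (i + j + d - 2),
          b i j (V.cls f hf) (V.cls g hg) = V.cls (V.bracket (i + d - 2) f g) hfg) ∧
      TZ.IsGradedLie (k := k) (L := fun i => V.HC (i + d - 2)) b := by
  have h1 : (1 : ℕ∞) ≤ 3 := by norm_num
  have h2 : (2 : ℕ∞) ≤ 3 := by norm_num
  refine ⟨fun m f hf => ⟨V.delta_mem hf, V.delta_delta h1 hf⟩,
    fun m₁ m₂ f hf g hg => ⟨V.bracket_mem hf hg, V.bracket_skew hf hg, V.delta_bracket h2 hf hg⟩,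
    fun m₁ m₂ m₃ f hf g hg h hh => ⟨V.homotopy_mem hf hg hh, V.jacobi_homotopy le_rfl hf hg hh⟩,
    _, fun i j f g hf hg => ⟨?_, ?_⟩, V.isGradedLie_bracketHC le_rfl⟩
  · exact V.bracket_mem_Z h2 (by ring) hf hg
  · rw [TZ.VAlgebra.bracketHC_cls]
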